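/- Let $V_0:\mathbb R\to\mathbb R$ be $1$-periodic with $V_0\in L^1[0,1]$, let $V:[0,\infty)\to\mathbb R$ be locally integrable, and let $L>0$. Put $V_L=V$ on $[0,L]$ and $V_L=0$ on $(L,\infty)$. Solutions of $-u''+qu=zu$ on $[0,\infty)$ are understood in the usual sense ($u'$ is locally absolutely continuous and the equation holds a.e.). Let $S\subset\mathbb R$ be the union of the open spectral bands of $-u''+V_0u$, i.e. the set of real $E$ for which the transfer matrix over one period has trace in $(-2,2)$. For $E\in S$ let $\varphi(\cdot,E)$ be a Floquet solution, that is, a solution of $-\varphi''+V_0\varphi=E\varphi$ of the form $\varphi(x,E)=J(x,E)e^{ikx}$ with $k\in\mathbb R$ and $J(\cdot,E)$ $1$-periodic, chosen between $\varphi$ and $\overline\varphi$ so that the (constant) Wronskian $W(\overline\varphi,\varphi)=\overline\varphi\,\varphi'-\overline\varphi\,'\varphi$ equals $i\omega$ with $\omega>0$. Let $u(\cdot,E)$ be the solution of $-u''+(V_0+V)u=Eu$ with $u(0,E)=0$, $u'(0,E)=1$, let $\rho(x,E)\in\mathbb C$ be determined by $$\begin{pmatrix}u\\u'\end{pmatrix}=\frac1{2i}\left[\rho\begin{pmatrix}\varphi\\\varphi'\end{pmatrix}-\overline\rho\begin{pmatrix}\overline\varphi\\\overline\varphi\,'\end{pmatrix}\right],$$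 and let $R(x,E)=|\rho(x,E)|$ be the generalized Prüfer amplitude. Let $\mu_L$ be the spectral measure of $-u''+(V_0+V_L)u$ on $[0,\infty)$ with Dirichlet condition at $0$, i.e. the Borel measure on $\mathbb R$ with $\int\frac{d\mu_L(x)}{1+x^2}<\infty$ and, for some $C\in\mathbb R$ and all $z\in\mathbb C\setminus\mathbb R$, $$m(z)=C+\int_{\mathbb R}\left[\frac1{x-z}-\frac{x}{1+x^2}\right]d\mu_L(x),$$ where $m(z)$ is the unique complex number such that $\tilde v+m(z)\tilde u\in L^2(0,\infty)$, and $\tilde v,\tilde u$ are the solutions of $-y''+(V_0+V_L)y=zy$ with $\tilde v(0)=1,\ \tilde v'(0)=0$, $\tilde u(0)=0,\ \tilde u'(0)=1$. Then $\mu_L$ is absolutely continuous on $S$ and $$\frac{d\mu_L}{dE}(E)=\frac{2}{\pi\,|W(\overline\varphi,\varphi)|}\,\frac1{R(L,E)^2}\qquad\text{for every }E\in S,$$ both as the density of $\mu_L$ on $S$ and as the pointwise derivative of the distribution function of $\mu_L$ at every $E\in S$. -/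

import Mathlib

open MeasureTheory Set Filter Topology ComplexConjugate

noncomputable section

namespace HalfLine

/-- The derivative of a function on the half-line `[0, ∞)` (one-sided at `0`). -/
def hderiv (u : ℝ → ℂ) (x : ℝ) : ℂ := derivWithin u (Ici 0) x

/-- `u` solves `-u'' + q u = z u` on `[0, ∞)` in the usual sense for a locally integrable real
potential `q`: `u` is differentiable, `u'` is locally absolutely continuous and the equation holds
almost everywhere. The last two requirements are written in integrated form. Values of `u` and `q`
at negative arguments play no role. -/
structure IsSolution (q : ℝ → ℝ) (z : ℂ) (u : ℝ → ℂ) : Prop where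
  differentiableOn : DifferentiableOn ℝ u (Ici 0)
  hderiv_eq : ∀ x, 0 ≤ x → hderiv u x = hderiv u 0 + ∫ t in (0 : ℝ)..x, ((q t : ℂ) - z) * u t

/-- The solution satisfying the Dirichlet condition at `0`: `u(0) = 0`, `u'(0) = 1`. -/
structure IsDirichletSolution (q : ℝ → ℝ) (z : ℂ) (u : ℝ → ℂ) : Prop where
  isSolution : IsSolution q z u
  zero : u 0 = 0
  hderiv_zero : hderiv u 0 = 1

/-- The solution satisfying the Neumann condition at `0`: `v(0) = 1`, `v'(0) = 0`. -/
structure IsNeumannSolution (q : ℝ → ℝ) (z : ℂ) (v : ℝ → ℂ) : Prop where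
  isSolution : IsSolution q z v
  zero : v 0 = 1
  hderiv_zero : hderiv v 0 = 0

/-- The Wronskian `W(f, g) = f g' - f' g` at the point `x`. -/
def wronskian (f g : ℝ → ℂ) (x : ℝ) : ℂ := f x * hderiv g x - hderiv f x * g x

/-- The union `S` of the open spectral bands of the operator `-u'' + V₀ u` with a 1-periodic
potential: the real energies whose transfer matrix
`Q = (v(1), u(1); v'(1), u'(1))` over one period satisfies `|Tr Q| < 2`. -/
def bands (V₀ : ℝ → ℝ) : Set ℝ :=
  {E | ∃ v u : ℝ → ℂ, IsNeumannSolution V₀ (E : ℂ) v ∧ IsDirichletSolution V₀ (E : ℂ) u ∧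
    ‖v 1 + hderiv u 1‖ < 2}

/-- `φ` is a Floquet solution at the real energy `E`: a solution of `-φ'' + V₀ φ = E φ` of the form
`φ(x) = J(x) exp(i k x)` with `J` 1-periodic and `k` real, normalized so that
`W(conj φ, φ) = i ω` with `ω > 0`.  (For `E` in a band `k` is, modulo `2π`, plus or minus the
quasimomentum in `(0, π)`; the sign of the Wronskian selects one of `φ` and `conj φ`, and `φ` is
then unique up to a nonzero constant factor.) -/
structure IsFloquetSolution (V₀ : ℝ → ℝ) (E : ℝ) (φ : ℝ → ℂ) : Prop where
  isSolution : IsSolution V₀ (E : ℂ) φ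
  floquet : ∃ (k : ℝ) (J : ℝ → ℂ), Function.Periodic J 1 ∧
    ∀ x, 0 ≤ x → φ x = J x * Complex.exp (Complex.I * k * x)
  wronskian_eq : ∃ ω : ℝ, 0 < ω ∧
    ∀ x, 0 ≤ x → wronskian (fun t => conj (φ t)) φ x = Complex.I * ω

/-- `ρ` is the complex generalized Prüfer variable of the solution `u` with respect to `φ`:
`(u, u') = (1 / 2i) [ρ (φ, φ') - conj ρ (conj φ, conj φ')]` on `[0, ∞)`.
The generalized Prüfer amplitude is `R(x) = |ρ(x)|`. -/
structure IsPrufer (φ u ρ : ℝ → ℂ) : Prop where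
  value : ∀ x, 0 ≤ x →
    u x = 1 / (2 * Complex.I) * (ρ x * φ x - conj (ρ x) * conj (φ x))
  hderiv_value : ∀ x, 0 ≤ x →
    hderiv u x = 1 / (2 * Complex.I) * (ρ x * hderiv φ x - conj (ρ x) * conj (hderiv φ x))

/-- `m` is the value at `z` of the Weyl m-function of `-u'' + q u` on the half-line with Dirichlet
condition: the unique complex number such that `v + m u` belongs to `L²(0, ∞)`, where `v`, `u`
are the solutions at `z` with `v(0) = 1, v'(0) = 0` and `u(0) = 0, u'(0) = 1`. -/
def IsWeylM (q : ℝ → ℝ) (z m : ℂ) : Prop :=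
  ∃ v u : ℝ → ℂ, IsNeumannSolution q z v ∧ IsDirichletSolution q z u ∧
    MemLp (fun x => v x + m * u x) 2 (volume.restrict (Ioi 0)) ∧
    ∀ m' : ℂ, MemLp (fun x => v x + m' * u x) 2 (volume.restrict (Ioi 0)) → m' = m

/-- `μ` is the spectral measure of `-u'' + q u` on the half-line with Dirichlet condition at `0`:
`∫ dμ(x) / (1 + x²) < ∞`, and
`m(z) = C + ∫ [1 / (x - z) - x / (1 + x²)] dμ(x)` for all non-real `z`, with a real constant `C`. -/
structure IsSpectralMeasure (q : ℝ → ℝ) (μ : Measure ℝ) : Prop where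
  integrable : Integrable (fun x : ℝ => 1 / (1 + x ^ 2)) μ
  herglotz : ∃ C : ℝ, ∀ z : ℂ, z.im ≠ 0 →
    IsWeylM q z ((C : ℂ) + ∫ x : ℝ, (1 / ((x : ℂ) - z) - (x : ℂ) / (1 + (x : ℂ) ^ 2)) ∂μ)

/-- The cut-off potential: `V` on `[0, L]` and `0` elsewhere. -/
def cutoff (V : ℝ → ℝ) (L : ℝ) : ℝ → ℝ := (Icc 0 L).indicator V

end HalfLine

end

/-!
The `m`-function of the cut-off operator has boundary values on the bands that can be computed
explicitly, and Stieltjes inversion turns them into the density of the spectral measure.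

*Boundary values.* For `Im z > 0` the Weyl solution `f = v + m(z) u` is square-integrable. Beyond an
integer `N > L` the equation is periodic, so `f(· + 1)` solves the same equation as `f` and the
Wronskian of the two is constant along `N + ℕ`. Square-integrability makes `f` and `f'` decay along
`N + ℕ`, hence this Wronskian vanishes (`wronskian_translate_eq_zero`). This is a quadratic equation
for `m(z)`, and no analysis of Floquet multipliers at complex energies is needed. Its coefficients
are continuous in `z` (`tendsto_solution`), and at an energy `E` in a band its roots are the
coefficient `m₀` for which `v + m₀ u` is a multiple of the Floquet solution on `[L, ∞)`, and
`conj m₀` (`exists_boundary_value`); the leading coefficient is nonzero because the Floquet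
multiplier is not real. Two constant Wronskians, `W(conj f, f)` and `W(f, u)` for `f = v + m₀ u`,
evaluated at `0` and at `L`, give `Im m₀ = 2 / (ω R(L)²) > 0`. Since `Im m(z) ≥ 0`, the value `m(z)`
has to converge to `m₀` rather than to `conj m₀` as `z → E` (`tendsto_root_of_tendsto_coeff`).

*Inversion.* The approach to the boundary is unrestricted, so the boundary function is continuous on
the open set of band energies, and the Poisson integral of the measure is bounded near compact
subintervals. Integrating the Poisson integral over such an interval and passing to the limit gives
the measure of the interval as the integral of the boundary function over `π`
(`pi_mul_measureReal_Ioc`), from which both assertions follow.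

Solutions are handled through the first-order system in integrated form (`IsSystemSolution`);
existence, uniqueness and continuous dependence on the energy for integrable coefficients come from
the Volterra series and Gronwall's inequality.
-/

open MeasureTheory Set Filter Topology ComplexConjugate

namespace HalfLine

/-! ### Iterated primitives and Gronwall's inequality -/

/-- The chain rule for powers of an absolutely continuous primitive. -/
theorem integral_mul_primitive_pow {a : ℝ → ℝ} {x : ℝ} (ha : IntervalIntegrable a volume 0 x)
    (n : ℕ) :
    ∫ t in (0 : ℝ)..x, a t * (∫ s in (0 : ℝ)..t, a s) ^ n =
      (∫ s in (0 : ℝ)..x, a s) ^ (n + 1) / (n + 1) := by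
  set A : ℝ → ℝ := fun t => ∫ s in (0 : ℝ)..t, a s with hA
  have hAC : AbsolutelyContinuousOnInterval A 0 x :=
    ha.absolutelyContinuousOnInterval_intervalIntegral (c := 0) (by simp)
  have hpow : ∀ k : ℕ, AbsolutelyContinuousOnInterval (fun t => A t ^ (k + 1)) 0 x := by
    intro k
    induction k with
    | zero => simpa using hAC
    | succ k ih =>
      have := ih.fun_mul hAC
      simpa only [pow_succ] using this
  have h1 := (hpow n).integral_deriv_eq_sub
  have hn : ((n : ℝ) + 1) ≠ 0 := by positivity
  have h2 : ∫ t in (0 : ℝ)..x, deriv (fun t => A t ^ (n + 1)) t =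
      ∫ t in (0 : ℝ)..x, ((n : ℝ) + 1) * (a t * A t ^ n) := by
    apply intervalIntegral.integral_congr_ae
    filter_upwards [ha.ae_hasDerivAt_integral] with t ht hmem
    have h := (ht (uIoc_subset_uIcc hmem) 0 (by simp)).pow (n + 1)
    have := h.deriv
    simp only [Nat.cast_add, Nat.cast_one, Nat.add_sub_cancel] at this
    rw [show (fun t => A t ^ (n + 1)) = A ^ (n + 1) from rfl, this]
    ring
  rw [h2, intervalIntegral.integral_const_mul] at h1
  have h0 : A 0 = 0 := by simp [hA]
  rw [h0, zero_pow (by omega), sub_zero] at h1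
  change ∫ t in (0 : ℝ)..x, a t * A t ^ n = A x ^ (n + 1) / (n + 1)
  rw [← h1]
  field_simp

/-- Gronwall's inequality with a merely integrable coefficient. -/
theorem le_mul_exp_of_le_add_integral {a h : ℝ → ℝ} {X C : ℝ}
    (ha : IntervalIntegrable a volume 0 X) (ha0 : ∀ t, 0 ≤ a t)
    (hcont : ContinuousOn h (Icc 0 X))
    (hle : ∀ x ∈ Icc 0 X, h x ≤ C + ∫ t in (0 : ℝ)..x, a t * h t) :
    ∀ x ∈ Icc 0 X, h x ≤ C * Real.exp (∫ t in (0 : ℝ)..x, a t) := by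
  intro y hy
  have hX : 0 ≤ X := hy.1.trans hy.2
  set A : ℝ → ℝ := fun t => ∫ s in (0 : ℝ)..t, a s with hA
  obtain ⟨M, hM⟩ := isCompact_Icc.bddAbove_image hcont
  have haX : ∀ x ∈ Icc (0 : ℝ) X, IntervalIntegrable a volume 0 x := fun x hx =>
    ha.mono_set (by rw [uIcc_of_le hx.1, uIcc_of_le hX]; exact Icc_subset_Icc_right hx.2)
  have hAc : ContinuousOn A (Icc 0 X) := by
    have := intervalIntegral.continuousOn_primitive_interval (f := a) (μ := volume)
      (a := 0) (b := X)
      (by rw [uIcc_of_le hX]; exact (intervalIntegrable_iff_integrableOn_Icc_of_le hX).1 ha)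
    rwa [uIcc_of_le hX] at this
  -- iterating the hypothesis `n` times leaves a partial sum of the exponential series
  have key : ∀ n : ℕ, ∀ x ∈ Icc (0 : ℝ) X,
      h x ≤ C * (∑ k ∈ Finset.range n, A x ^ k / (k.factorial : ℝ)) +
        M * (A x ^ n / n.factorial) := by
    intro n
    induction n with
    | zero =>
      intro x hx
      simpa using hM (mem_image_of_mem h hx)
    | succ n ih =>
      intro x hx
      have hxX : Icc 0 x ⊆ Icc 0 X := Icc_subset_Icc_right hx.2
      have hint : ∀ p : ℝ → ℝ, ContinuousOn p (Icc 0 X) →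
          IntervalIntegrable (fun t => a t * p t) volume 0 x := fun p hp =>
        (haX x hx).mul_continuousOn (by rw [uIcc_of_le hx.1]; exact hp.mono hxX)
      refine (hle x hx).trans ?_
      have h1 : ∫ t in (0 : ℝ)..x, a t * h t ≤ ∫ t in (0 : ℝ)..x,
          a t * (C * (∑ k ∈ Finset.range n, A t ^ k / (k.factorial : ℝ)) +
            M * (A t ^ n / n.factorial)) := by
        apply intervalIntegral.integral_mono_on hx.1 (hint _ hcont) (hint _ (by fun_prop))
        intro t ht
        exact mul_le_mul_of_nonneg_left (ih t (hxX ht)) (ha0 t)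
      have hterm : ∀ k : ℕ, ∫ t in (0 : ℝ)..x, a t * (A t ^ k / (k.factorial : ℝ)) =
          A x ^ (k + 1) / ((k + 1).factorial : ℝ) := by
        intro k
        have : ∫ t in (0 : ℝ)..x, a t * A t ^ k = A x ^ (k + 1) / (k + 1) :=
          integral_mul_primitive_pow (haX x hx) k
        simp_rw [← mul_div_assoc]
        rw [intervalIntegral.integral_div, this, Nat.factorial_succ]
        push_cast
        field_simp
      have h2 : ∫ t in (0 : ℝ)..x,
          a t * (C * (∑ k ∈ Finset.range n, A t ^ k / (k.factorial : ℝ)) +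
            M * (A t ^ n / n.factorial)) =
          C * (∑ k ∈ Finset.range n, A x ^ (k + 1) / ((k + 1).factorial : ℝ)) +
            M * (A x ^ (n + 1) / ((n + 1).factorial : ℝ)) := by
        rw [← hterm n, Finset.sum_congr rfl (fun k _ => (hterm k).symm),
          ← intervalIntegral.integral_finsetSum (fun k _ => hint _ (by fun_prop)),
          ← intervalIntegral.integral_const_mul, ← intervalIntegral.integral_const_mul,
          ← intervalIntegral.integral_add]
        · congr 1; ext t; rw [← Finset.mul_sum]; ring
        · simp_rw [← Finset.mul_sum]
          exact (hint _ (by fun_prop)).const_mul C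
        · exact (hint _ (by fun_prop)).const_mul M
      rw [Finset.sum_range_succ']
      simp only [pow_zero, Nat.factorial_zero, Nat.cast_one, div_one]
      linarith
  have hlim : Tendsto (fun n : ℕ => C * (∑ k ∈ Finset.range n, A y ^ k / (k.factorial : ℝ)) +
      M * (A y ^ n / n.factorial)) atTop (𝓝 (C * Real.exp (A y) + M * 0)) := by
    refine Tendsto.add (Tendsto.const_mul _ ?_) (Tendsto.const_mul _ ?_)
    · rw [Real.exp_eq_exp_ℝ]
      exact (NormedSpace.expSeries_div_hasSum_exp (A y)).tendsto_sum_nat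
    · exact FloorSemiring.tendsto_pow_div_factorial_atTop (A y)
  rw [mul_zero, add_zero] at hlim
  exact ge_of_tendsto' hlim fun n => key n y hy

/-! ### Existence of solutions -/

/-- Picard iterates for the first-order system `f' = g`, `g' = (q - z) f` with initial values
`f(0) = α`, `g(0) = β`: the `n`-th pair is the term of order `n` of the Volterra series. -/
noncomputable def picardIterate (q : ℝ → ℝ) (z α β : ℂ) : ℕ → (ℝ → ℂ) × (ℝ → ℂ)
  | 0 => (fun _ => α, fun _ => β)
  | n + 1 => (fun x => ∫ t in (0 : ℝ)..x, (picardIterate q z α β n).2 t,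
      fun x => ∫ t in (0 : ℝ)..x, ((q t : ℂ) - z) * (picardIterate q z α β n).1 t)

theorem intervalIntegrable_sub_mul {q : ℝ → ℝ} {z : ℂ} {f : ℝ → ℂ} {a b : ℝ}
    (hq : IntervalIntegrable q volume a b) (hf : ContinuousOn f (uIcc a b)) :
    IntervalIntegrable (fun t => ((q t : ℂ) - z) * f t) volume a b := by
  have h : IntervalIntegrable (fun t => ((q t : ℂ) - z)) volume a b :=
    (show IntervalIntegrable (fun t => (q t : ℂ)) volume a b from
      ⟨hq.1.ofReal, hq.2.ofReal⟩).sub intervalIntegrable_const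
  exact h.mul_continuousOn hf

theorem continuousOn_primitive_Icc {f : ℝ → ℂ} {X : ℝ} (hX : 0 ≤ X)
    (hf : IntervalIntegrable f volume 0 X) :
    ContinuousOn (fun x => ∫ t in (0 : ℝ)..x, f t) (Icc 0 X) := by
  have := intervalIntegral.continuousOn_primitive_interval (f := f) (μ := volume)
    (a := 0) (b := X)
    (by rw [uIcc_of_le hX]; exact (intervalIntegrable_iff_integrableOn_Icc_of_le hX).1 hf)
  rwa [uIcc_of_le hX] at this

theorem intervalIntegrable_weight {q : ℝ → ℝ} (z : ℂ) {a b : ℝ}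
    (hq : IntervalIntegrable q volume a b) :
    IntervalIntegrable (fun t => 1 + ‖(q t : ℂ) - z‖) volume a b := by
  have h : IntervalIntegrable (fun t => ((q t : ℂ) - z)) volume a b :=
    (show IntervalIntegrable (fun t => (q t : ℂ)) volume a b from
      ⟨hq.1.ofReal, hq.2.ofReal⟩).sub intervalIntegrable_const
  exact intervalIntegrable_const.add h.norm

theorem picardIterate_continuousOn {q : ℝ → ℝ} {X : ℝ} (hX : 0 ≤ X)
    (hq : IntervalIntegrable q volume 0 X) (z α β : ℂ) (n : ℕ) :
    ContinuousOn (picardIterate q z α β n).1 (Icc 0 X) ∧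
      ContinuousOn (picardIterate q z α β n).2 (Icc 0 X) := by
  induction n with
  | zero => exact ⟨continuousOn_const, continuousOn_const⟩
  | succ n ih =>
    rw [← uIcc_of_le hX] at ih
    exact ⟨continuousOn_primitive_Icc hX ih.2.intervalIntegrable,
      continuousOn_primitive_Icc hX (intervalIntegrable_sub_mul hq ih.1)⟩

theorem norm_picardIterate_le {q : ℝ → ℝ} {X : ℝ}
    (hq : IntervalIntegrable q volume 0 X) (z α β : ℂ) (n : ℕ) :
    ∀ x ∈ Icc 0 X,
      ‖(picardIterate q z α β n).1 x‖ ≤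
        (‖α‖ + ‖β‖) * ((∫ t in (0 : ℝ)..x, (1 + ‖(q t : ℂ) - z‖)) ^ n / n.factorial) ∧
      ‖(picardIterate q z α β n).2 x‖ ≤
        (‖α‖ + ‖β‖) * ((∫ t in (0 : ℝ)..x, (1 + ‖(q t : ℂ) - z‖)) ^ n / n.factorial) := by
  induction n with
  | zero => intro x _; simp [picardIterate]
  | succ n ih =>
    intro x hx
    have hx0 := hx.1
    have hqx : IntervalIntegrable q volume 0 x :=
      hq.mono_set (by
        rw [uIcc_of_le hx.1, uIcc_of_le (hx.1.trans hx.2)]; exact Icc_subset_Icc_right hx.2)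
    set a : ℝ → ℝ := fun t => 1 + ‖(q t : ℂ) - z‖ with ha
    have hai : IntervalIntegrable a volume 0 x := intervalIntegrable_weight z hqx
    set A : ℝ → ℝ := fun t => ∫ s in (0 : ℝ)..t, a s with hA
    set K : ℝ := ‖α‖ + ‖β‖
    have hAc : ContinuousOn A (uIcc 0 x) := by
      refine intervalIntegral.continuousOn_primitive_interval ?_
      rw [uIcc_of_le hx0]
      exact (intervalIntegrable_iff_integrableOn_Icc_of_le hx0).1 hai
    have hint : IntervalIntegrable (fun t => a t * (K * (A t ^ n / n.factorial))) volume 0 x :=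
      hai.mul_continuousOn (by fun_prop)
    have hval : ∫ t in (0 : ℝ)..x, a t * (K * (A t ^ n / n.factorial)) =
        K * (A x ^ (n + 1) / (n + 1).factorial) := by
      have h : ∫ t in (0 : ℝ)..x, a t * A t ^ n = A x ^ (n + 1) / (n + 1) :=
        integral_mul_primitive_pow hai n
      have h' : ∀ t, a t * (K * (A t ^ n / n.factorial)) =
          (K / n.factorial) * (a t * A t ^ n) := fun t => by ring
      simp_rw [h']
      rw [intervalIntegral.integral_const_mul, h, Nat.factorial_succ]
      push_cast
      field_simp
    have hbd : ∀ t ∈ Ioc 0 x, ∀ c y : ℂ, ‖c‖ ≤ a t →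
        ‖y‖ ≤ K * (A t ^ n / n.factorial) → ‖c * y‖ ≤ a t * (K * (A t ^ n / n.factorial)) := by
      intro t ht c y hc hy
      rw [norm_mul]
      exact mul_le_mul hc hy (norm_nonneg _) ((norm_nonneg _).trans hc)
    have hmem : ∀ t ∈ Ioc 0 x, t ∈ Icc 0 X := fun t ht => ⟨ht.1.le, ht.2.trans hx.2⟩
    constructor
    · rw [← hval]
      refine intervalIntegral.norm_integral_le_of_norm_le hx0 (Eventually.of_forall ?_) hint
      intro t ht
      simpa using hbd t ht 1 _ (by simp [ha]) (ih t (hmem t ht)).2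
    · rw [← hval]
      refine intervalIntegral.norm_integral_le_of_norm_le hx0 (Eventually.of_forall ?_) hint
      intro t ht
      exact hbd t ht _ _ (by simp [ha]) (ih t (hmem t ht)).1

/-- A continuous pair solving the integrated first-order system is a solution, and its second
component is the derivative. -/
theorem isSolution_of_integral_eq {q : ℝ → ℝ} {z : ℂ} {f g : ℝ → ℂ}
    (hg : ∀ X, 0 ≤ X → ContinuousOn g (Icc 0 X))
    (hfg : ∀ x, 0 ≤ x → f x = f 0 + ∫ t in (0 : ℝ)..x, g t)
    (hgf : ∀ x, 0 ≤ x → g x = g 0 + ∫ t in (0 : ℝ)..x, ((q t : ℂ) - z) * f t) :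
    IsSolution q z f ∧ ∀ x, 0 ≤ x → hderiv f x = g x := by
  -- `g` is extended to the left of `0` by a constant to make the primitive differentiable there
  have hgc : Continuous (fun t => g (max 0 t)) := by
    rw [continuous_iff_continuousAt]
    intro x
    have h1 : ContinuousOn (fun t => g (max 0 t)) (Iic (x + 1)) := by
      refine (hg (max 0 (x + 1)) (le_max_left _ _)).comp (by fun_prop) ?_
      intro t ht
      exact ⟨le_max_left _ _, max_le_max le_rfl ht⟩
    exact h1.continuousAt (Iic_mem_nhds (by linarith))
  have hder : ∀ x, 0 ≤ x → HasDerivWithinAt f (g x) (Ici 0) x := by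
    intro x hx
    have h1 : HasDerivAt (fun y => f 0 + ∫ t in (0 : ℝ)..y, g (max 0 t)) (g (max 0 x)) x :=
      (intervalIntegral.integral_hasDerivAt_right (hgc.intervalIntegrable _ _)
        (hgc.stronglyMeasurableAtFilter _ _) hgc.continuousAt).const_add _
    rw [max_eq_right hx] at h1
    have heq : ∀ y ∈ Ici (0 : ℝ), f y = f 0 + ∫ t in (0 : ℝ)..y, g (max 0 t) := by
      intro y hy
      rw [hfg y hy]
      congr 1
      refine intervalIntegral.integral_congr fun t ht => ?_
      rw [uIcc_of_le hy] at ht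
      simp only [max_eq_right ht.1]
    exact h1.hasDerivWithinAt.congr heq (heq x hx)
  have hh : ∀ x, 0 ≤ x → hderiv f x = g x := fun x hx =>
    (hder x hx).derivWithin (uniqueDiffOn_Ici 0 x hx)
  refine ⟨⟨fun x hx => (hder x hx).differentiableWithinAt, fun x hx => ?_⟩, hh⟩
  rw [hh x hx, hh 0 le_rfl, hgf x hx]

/-- Existence of solutions with prescribed initial values, by summing the Volterra series. -/
theorem exists_isSolution {q : ℝ → ℝ} (hq : ∀ X, 0 ≤ X → IntervalIntegrable q volume 0 X)
    (z α β : ℂ) : ∃ u, IsSolution q z u ∧ u 0 = α ∧ hderiv u 0 = β := by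
  set p := picardIterate q z α β with hp
  set A : ℝ → ℝ := fun x => ∫ t in (0 : ℝ)..x, (1 + ‖(q t : ℂ) - z‖) with hA
  set K : ℝ := ‖α‖ + ‖β‖ with hK
  have hA0 : ∀ x, 0 ≤ x → 0 ≤ A x := fun x hx =>
    intervalIntegral.integral_nonneg hx fun t _ => by positivity
  have hAmono : ∀ x X, 0 ≤ x → x ≤ X → A x ≤ A X := fun x X hx hxX => by
    refine intervalIntegral.integral_mono_interval le_rfl hx hxX
      (Eventually.of_forall fun t => by positivity)
      (intervalIntegrable_weight z (hq X (hx.trans hxX)))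
  have hbd : ∀ X, 0 ≤ X → ∀ n, ∀ x ∈ Icc 0 X, ‖(p n).1 x‖ ≤ K * (A X ^ n / n.factorial) ∧
      ‖(p n).2 x‖ ≤ K * (A X ^ n / n.factorial) := by
    intro X hX n x hx
    have h := norm_picardIterate_le (hq X hX) z α β n x hx
    have h2 : K * (A x ^ n / n.factorial) ≤ K * (A X ^ n / n.factorial) := by
      have := hA0 x hx.1
      have := hAmono x X hx.1 hx.2
      gcongr
    exact ⟨h.1.trans h2, h.2.trans h2⟩
  have hsum : ∀ X, Summable fun n : ℕ => K * (A X ^ n / n.factorial) := fun X =>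
    (Real.summable_pow_div_factorial (A X)).mul_left K
  have hs1 : ∀ x, 0 ≤ x → Summable fun n => (p n).1 x := fun x hx =>
    Summable.of_norm_bounded (hsum x) fun n => (hbd x hx n x ⟨hx, le_rfl⟩).1
  have hs2 : ∀ x, 0 ≤ x → Summable fun n => (p n).2 x := fun x hx =>
    Summable.of_norm_bounded (hsum x) fun n => (hbd x hx n x ⟨hx, le_rfl⟩).2
  set f : ℝ → ℂ := fun x => ∑' n, (p n).1 x with hf
  set g : ℝ → ℂ := fun x => ∑' n, (p n).2 x with hg
  have hgc : ∀ X, 0 ≤ X → ContinuousOn g (Icc 0 X) := fun X hX =>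
    continuousOn_tsum (fun n => (picardIterate_continuousOn hX (hq X hX) z α β n).2) (hsum X)
      fun n x hx => (hbd X hX n x hx).2
  have h10 : ∀ n, (p (n + 1)).1 0 = 0 := fun n => by simp [hp, picardIterate]
  have h20 : ∀ n, (p (n + 1)).2 0 = 0 := fun n => by simp [hp, picardIterate]
  have hf0 : f 0 = α := by
    rw [hf]; simp only
    rw [tsum_eq_single 0]
    · simp [hp, picardIterate]
    · intro n hn
      obtain ⟨m, rfl⟩ := Nat.exists_eq_succ_of_ne_zero hn
      exact h10 m
  have hg0 : g 0 = β := by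
    rw [hg]; simp only
    rw [tsum_eq_single 0]
    · simp [hp, picardIterate]
    · intro n hn
      obtain ⟨m, rfl⟩ := Nat.exists_eq_succ_of_ne_zero hn
      exact h20 m
  have hmeas : ∀ x, 0 ≤ x → ∀ F : ℝ → ℂ, IntervalIntegrable F volume 0 x →
      AEStronglyMeasurable F (volume.restrict (uIoc 0 x)) := fun x hx F hF => by
    rw [uIoc_of_le hx]; exact hF.1.aestronglyMeasurable
  have hmem : ∀ x : ℝ, 0 ≤ x → ∀ t ∈ uIoc 0 x, t ∈ Icc 0 x := fun x hx t ht => by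
    rw [uIoc_of_le hx] at ht; exact ⟨ht.1.le, ht.2⟩
  have hfeq : ∀ x, 0 ≤ x → f x = f 0 + ∫ t in (0 : ℝ)..x, g t := by
    intro x hx
    have h : HasSum (fun n => ∫ t in (0 : ℝ)..x, (p n).2 t) (∫ t in (0 : ℝ)..x, g t) := by
      refine intervalIntegral.hasSum_integral_of_dominated_convergence
        (fun n _ => K * (A x ^ n / n.factorial)) (fun n => hmeas x hx _ ?_)
        (fun n => Eventually.of_forall fun t ht => (hbd x hx n t (hmem x hx t ht)).2)
        (Eventually.of_forall fun t _ => hsum x) intervalIntegrable_const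
        (Eventually.of_forall fun t ht => (hs2 t (hmem x hx t ht).1).hasSum)
      refine ContinuousOn.intervalIntegrable ?_
      rw [uIcc_of_le hx]
      exact (picardIterate_continuousOn hx (hq x hx) z α β n).2
    have h2 := (hs1 x hx).hasSum
    rw [← hasSum_nat_add_iff' 1] at h2
    have := h2.unique h
    simp only [Finset.range_one, Finset.sum_singleton] at this
    rw [hf0, ← this]
    simp [hp, picardIterate, hf]
  have hgeq : ∀ x, 0 ≤ x → g x = g 0 + ∫ t in (0 : ℝ)..x, ((q t : ℂ) - z) * f t := by
    intro x hx
    have h : HasSum (fun n => ∫ t in (0 : ℝ)..x, ((q t : ℂ) - z) * (p n).1 t)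
        (∫ t in (0 : ℝ)..x, ((q t : ℂ) - z) * f t) := by
      refine intervalIntegral.hasSum_integral_of_dominated_convergence
        (fun n t => (1 + ‖(q t : ℂ) - z‖) * (K * (A x ^ n / n.factorial)))
        (fun n => hmeas x hx _ ?_)
        (fun n => Eventually.of_forall fun t ht => ?_)
        (Eventually.of_forall fun t _ => (hsum x).mul_left _) ?_
        (Eventually.of_forall fun t ht => ((hs1 t (hmem x hx t ht).1).hasSum.mul_left _))
      · refine intervalIntegrable_sub_mul (hq x hx) ?_
        rw [uIcc_of_le hx]
        exact (picardIterate_continuousOn hx (hq x hx) z α β n).1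
      · rw [norm_mul]
        exact mul_le_mul (by linarith) (hbd x hx n t (hmem x hx t ht)).1 (norm_nonneg _)
          (by positivity)
      · simp_rw [tsum_mul_left]
        exact (intervalIntegrable_weight z (hq x hx)).mul_const _
    have h2 := (hs2 x hx).hasSum
    rw [← hasSum_nat_add_iff' 1] at h2
    have := h2.unique h
    simp only [Finset.range_one, Finset.sum_singleton] at this
    rw [hg0, ← this]
    simp [hp, picardIterate, hg]
  obtain ⟨hsol, hd⟩ := isSolution_of_integral_eq hgc hfeq hgeq
  exact ⟨f, hsol, hf0, (hd 0 le_rfl).trans hg0⟩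

/-! ### The first-order system -/

/-- `(f, g)` solves the first-order system `f' = g`, `g' = (q - z) f` on `[0, X]`, in integrated
form. -/
structure IsSystemSolution (q : ℝ → ℝ) (z : ℂ) (X : ℝ) (f g : ℝ → ℂ) : Prop where
  continuousOn_fst : ContinuousOn f (Icc 0 X)
  continuousOn_snd : ContinuousOn g (Icc 0 X)
  fst_eq : ∀ x ∈ Icc 0 X, f x = f 0 + ∫ t in (0 : ℝ)..x, g t
  snd_eq : ∀ x ∈ Icc 0 X, g x = g 0 + ∫ t in (0 : ℝ)..x, ((q t : ℂ) - z) * f t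

theorem IsSolution.hasDerivWithinAt {q : ℝ → ℝ} {z : ℂ} {u : ℝ → ℂ} (hu : IsSolution q z u)
    {x : ℝ} (hx : 0 ≤ x) : HasDerivWithinAt u (hderiv u x) (Ici 0) x :=
  (hu.differentiableOn x hx).hasDerivWithinAt

theorem hderiv_eq_of_hasDerivWithinAt {u : ℝ → ℂ} {x : ℝ} {d : ℂ} (hx : 0 ≤ x)
    (h : HasDerivWithinAt u d (Ici 0) x) : hderiv u x = d :=
  h.derivWithin (uniqueDiffOn_Ici 0 x hx)

theorem IsSolution.isSystemSolution {q : ℝ → ℝ} {z : ℂ} {u : ℝ → ℂ} {X : ℝ}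
    (hu : IsSolution q z u) (hX : 0 ≤ X) (hq : IntervalIntegrable q volume 0 X) :
    IsSystemSolution q z X u (hderiv u) := by
  have hc : ContinuousOn u (Icc 0 X) := hu.differentiableOn.continuousOn.mono Icc_subset_Ici_self
  have hg : ContinuousOn (hderiv u) (Icc 0 X) := by
    have h1 : ContinuousOn (fun x => hderiv u 0 + ∫ t in (0 : ℝ)..x, ((q t : ℂ) - z) * u t)
        (Icc 0 X) :=
      continuousOn_const.add (continuousOn_primitive_Icc hX
        (intervalIntegrable_sub_mul hq (by rwa [uIcc_of_le hX])))
    exact h1.congr fun x hx => hu.hderiv_eq x hx.1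
  refine ⟨hc, hg, fun x hx => ?_, fun x hx => hu.hderiv_eq x hx.1⟩
  have hxX : Icc 0 x ⊆ Icc 0 X := Icc_subset_Icc_right hx.2
  have h := intervalIntegral.integral_eq_sub_of_hasDeriv_right_of_le hx.1 (hc.mono hxX)
    (fun t ht => (hu.hasDerivWithinAt ht.1.le).mono fun s hs => ht.1.le.trans (le_of_lt hs))
    (ContinuousOn.intervalIntegrable (by rw [uIcc_of_le hx.1]; exact hg.mono hxX))
  rw [h]; ring

namespace IsSystemSolution

variable {q q' : ℝ → ℝ} {z w : ℂ} {X : ℝ} {f g f' g' : ℝ → ℂ}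

theorem congr_potential (h : IsSystemSolution q z X f g) (hqq : ∀ x ∈ Ioc 0 X, q x = q' x) :
    IsSystemSolution q' z X f g := by
  refine ⟨h.1, h.2, h.3, fun x hx => ?_⟩
  rw [h.snd_eq x hx]
  congr 1
  refine intervalIntegral.integral_congr_ae (Eventually.of_forall fun t ht => ?_)
  rw [uIoc_of_le hx.1] at ht
  rw [hqq t ⟨ht.1, ht.2.trans hx.2⟩]

theorem intervalIntegrable_snd (h : IsSystemSolution q z X f g) {x : ℝ} (hx : x ∈ Icc 0 X) :
    IntervalIntegrable g volume 0 x :=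
  ContinuousOn.intervalIntegrable (by
    rw [uIcc_of_le hx.1]; exact h.continuousOn_snd.mono (Icc_subset_Icc_right hx.2))

theorem intervalIntegrable_fst (h : IsSystemSolution q z X f g) {x : ℝ} (hx : x ∈ Icc 0 X) :
    IntervalIntegrable f volume 0 x :=
  ContinuousOn.intervalIntegrable (by
    rw [uIcc_of_le hx.1]; exact h.continuousOn_fst.mono (Icc_subset_Icc_right hx.2))

theorem intervalIntegrable_potential_mul (h : IsSystemSolution q z X f g) {x : ℝ}
    (hx : x ∈ Icc 0 X) (hq : IntervalIntegrable q' volume 0 X) (w : ℂ) :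
    IntervalIntegrable (fun t => ((q' t : ℂ) - w) * f t) volume 0 x :=
  intervalIntegrable_sub_mul (hq.mono_set (by
      rw [uIcc_of_le hx.1, uIcc_of_le (hx.1.trans hx.2)]; exact Icc_subset_Icc_right hx.2)) (by
    rw [uIcc_of_le hx.1]; exact h.continuousOn_fst.mono (Icc_subset_Icc_right hx.2))

theorem linear_combination (hf : IsSystemSolution q z X f g) (hf' : IsSystemSolution q z X f' g')
    (hq : IntervalIntegrable q volume 0 X) (α β : ℂ) :
    IsSystemSolution q z X (fun x => α * f x + β * f' x) (fun x => α * g x + β * g' x) := by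
  have h1 := hf.1; have h2 := hf.2; have h3 := hf'.1; have h4 := hf'.2
  refine ⟨by fun_prop, by fun_prop, fun x hx => ?_, fun x hx => ?_⟩
  · rw [intervalIntegral.integral_add ((hf.intervalIntegrable_snd hx).const_mul α)
      ((hf'.intervalIntegrable_snd hx).const_mul β), intervalIntegral.integral_const_mul,
      intervalIntegral.integral_const_mul, hf.fst_eq x hx, hf'.fst_eq x hx]
    ring
  · have : ∀ t, ((q t : ℂ) - z) * (α * f t + β * f' t) =
        α * (((q t : ℂ) - z) * f t) + β * (((q t : ℂ) - z) * f' t) := fun t => by ring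
    simp_rw [this]
    rw [intervalIntegral.integral_add
      ((hf.intervalIntegrable_potential_mul hx hq z).const_mul α)
      ((hf'.intervalIntegrable_potential_mul hx hq z).const_mul β),
      intervalIntegral.integral_const_mul,
      intervalIntegral.integral_const_mul, hf.snd_eq x hx, hf'.snd_eq x hx]
    ring

/-- Complex conjugation preserves solutions at real energies. -/
theorem star {E : ℝ} (h : IsSystemSolution q (E : ℂ) X f g) :
    IsSystemSolution q (E : ℂ) X (fun x => conj (f x)) (fun x => conj (g x)) := by
  refine ⟨Complex.continuous_conj.comp_continuousOn h.1,
    Complex.continuous_conj.comp_continuousOn h.2, fun x hx => ?_, fun x hx => ?_⟩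
  · rw [h.fst_eq x hx, map_add, intervalIntegral.integral_of_le hx.1,
      intervalIntegral.integral_of_le hx.1, ← integral_conj]
  · rw [h.snd_eq x hx, map_add, intervalIntegral.integral_of_le hx.1,
      intervalIntegral.integral_of_le hx.1, ← integral_conj]
    simp

/-- Translation of a solution of `-u'' + q u = z u` by `a`. -/
theorem shift (h : IsSystemSolution q z X f g) (hq : IntervalIntegrable q volume 0 X) {a : ℝ}
    (ha : 0 ≤ a) :
    IsSystemSolution (fun x => q (x + a)) z (X - a) (fun x => f (x + a)) (fun x => g (x + a)) := by
  have hm : MapsTo (fun x => x + a) (Icc 0 (X - a)) (Icc 0 X) := fun x hx =>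
    ⟨by linarith [hx.1], by linarith [hx.2]⟩
  refine ⟨h.1.comp (by fun_prop) hm, h.2.comp (by fun_prop) hm, fun x hx => ?_, fun x hx => ?_⟩
  · have haX : a ∈ Icc 0 X := ⟨ha, by linarith [hx.1, hx.2]⟩
    rw [intervalIntegral.integral_comp_add_right, zero_add, h.fst_eq _ (hm hx), h.fst_eq a haX,
      add_assoc, intervalIntegral.integral_add_adjacent_intervals]
    · exact h.intervalIntegrable_snd haX
    · exact (h.intervalIntegrable_snd haX).symm.trans (h.intervalIntegrable_snd (hm hx))
  · have haX : a ∈ Icc 0 X := ⟨ha, by linarith [hx.1, hx.2]⟩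
    rw [intervalIntegral.integral_comp_add_right (fun t => ((q t : ℂ) - z) * f t), zero_add,
      h.snd_eq _ (hm hx), h.snd_eq a haX,
      add_assoc, intervalIntegral.integral_add_adjacent_intervals]
    · exact h.intervalIntegrable_potential_mul haX hq z
    · exact (h.intervalIntegrable_potential_mul haX hq z).symm.trans
        (h.intervalIntegrable_potential_mul (hm hx) hq z)

/-- Continuous dependence of solutions on the energy, with fixed initial values. -/
theorem dist_le (h : IsSystemSolution q z X f g) (h' : IsSystemSolution q w X f' g')
    (hq : IntervalIntegrable q volume 0 X) (h0 : f 0 = f' 0) (h1 : g 0 = g' 0) :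
    ∀ x ∈ Icc 0 X, ‖f x - f' x‖ + ‖g x - g' x‖ ≤
      (‖z - w‖ * ∫ t in (0 : ℝ)..X, ‖f' t‖) *
        Real.exp (∫ t in (0 : ℝ)..x, (1 + ‖(q t : ℂ) - z‖)) := by
  intro y hy
  have hX : 0 ≤ X := hy.1.trans hy.2
  have c1 := h.1; have c2 := h.2; have c3 := h'.1; have c4 := h'.2
  have hai := intervalIntegrable_weight z hq
  refine le_mul_exp_of_le_add_integral hai (fun t => by positivity)
    (h := fun x => ‖f x - f' x‖ + ‖g x - g' x‖) (by fun_prop) ?_ y hy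
  intro x hx
  have hx0 : 0 ≤ x := hx.1
  have hxX : Icc 0 x ⊆ Icc 0 X := Icc_subset_Icc_right hx.2
  have hint : ∀ p : ℝ → ℝ, ContinuousOn p (Icc 0 X) → IntervalIntegrable p volume 0 x :=
    fun p hp => ContinuousOn.intervalIntegrable (by rw [uIcc_of_le hx0]; exact hp.mono hxX)
  have e1 : f x - f' x = ∫ t in (0 : ℝ)..x, (g t - g' t) := by
    rw [intervalIntegral.integral_sub (h.intervalIntegrable_snd hx) (h'.intervalIntegrable_snd hx),
      h.fst_eq x hx, h'.fst_eq x hx, h0]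
    ring
  have e2 : g x - g' x = ∫ t in (0 : ℝ)..x, (((q t : ℂ) - z) * (f t - f' t) + (w - z) * f' t) := by
    have : ∀ t, ((q t : ℂ) - z) * (f t - f' t) + (w - z) * f' t =
        ((q t : ℂ) - z) * f t - ((q t : ℂ) - w) * f' t := fun t => by ring
    simp_rw [this]
    rw [intervalIntegral.integral_sub (h.intervalIntegrable_potential_mul hx hq z)
      (h'.intervalIntegrable_potential_mul hx hq w), h.snd_eq x hx, h'.snd_eq x hx, h1]
    ring
  have i1 : IntervalIntegrable (fun t => ‖g t - g' t‖) volume 0 x := hint _ (by fun_prop)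
  have i2 : IntervalIntegrable (fun t => ‖(q t : ℂ) - z‖ * ‖f t - f' t‖) volume 0 x := by
    have hcx : ContinuousOn (fun t => ‖f t - f' t‖) (uIcc 0 x) := by
      rw [uIcc_of_le hx0]
      exact (c1.sub c3).norm.mono hxX
    have hqx : IntervalIntegrable q volume 0 x := hq.mono_set (by
      rw [uIcc_of_le hx0, uIcc_of_le hX]; exact hxX)
    have := (intervalIntegrable_weight z hqx).sub
      (intervalIntegrable_const (c := (1 : ℝ)) (μ := volume))
    exact IntervalIntegrable.mul_continuousOn (by simpa using this) hcx
  have i3 : IntervalIntegrable (fun t => ‖z - w‖ * ‖f' t‖) volume 0 x := hint _ (by fun_prop)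
  have b1 : ‖f x - f' x‖ ≤ ∫ t in (0 : ℝ)..x, ‖g t - g' t‖ := by
    rw [e1]; exact intervalIntegral.norm_integral_le_integral_norm hx0
  have b2 : ‖g x - g' x‖ ≤
      ∫ t in (0 : ℝ)..x, (‖(q t : ℂ) - z‖ * ‖f t - f' t‖ + ‖z - w‖ * ‖f' t‖) := by
    rw [e2]
    refine intervalIntegral.norm_integral_le_of_norm_le hx0 (Eventually.of_forall fun t _ => ?_)
      (i2.add i3)
    refine (norm_add_le _ _).trans ?_
    rw [norm_mul, norm_mul, norm_sub_rev w z]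
  have b3 : ∫ t in (0 : ℝ)..x, ‖z - w‖ * ‖f' t‖ ≤ ‖z - w‖ * ∫ t in (0 : ℝ)..X, ‖f' t‖ := by
    rw [intervalIntegral.integral_const_mul]
    refine mul_le_mul_of_nonneg_left ?_ (norm_nonneg _)
    exact intervalIntegral.integral_mono_interval le_rfl hx0 hx.2
      (Eventually.of_forall fun t => norm_nonneg _)
      (h'.intervalIntegrable_fst ⟨hX, le_rfl⟩).norm
  have b4 : (∫ t in (0 : ℝ)..x, ‖g t - g' t‖) +
      ∫ t in (0 : ℝ)..x, ‖(q t : ℂ) - z‖ * ‖f t - f' t‖ ≤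
      ∫ t in (0 : ℝ)..x, (1 + ‖(q t : ℂ) - z‖) * (‖f t - f' t‖ + ‖g t - g' t‖) := by
    rw [← intervalIntegral.integral_add i1 i2]
    refine intervalIntegral.integral_mono_on hx0 (i1.add i2) ?_ fun t _ => ?_
    · refine (hai.mono_set ?_).mul_continuousOn ?_
      · rw [uIcc_of_le hx0, uIcc_of_le hX]; exact hxX
      · rw [uIcc_of_le hx0]
        exact ContinuousOn.mono (by fun_prop) hxX
    · nlinarith [norm_nonneg ((q t : ℂ) - z), norm_nonneg (f t - f' t), norm_nonneg (g t - g' t),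
        mul_nonneg (norm_nonneg ((q t : ℂ) - z)) (norm_nonneg (g t - g' t))]
  rw [intervalIntegral.integral_add i2 i3] at b2
  linarith

/-- Uniqueness for the initial value problem. -/
theorem unique (h : IsSystemSolution q z X f g) (h' : IsSystemSolution q z X f' g')
    (hq : IntervalIntegrable q volume 0 X) (h0 : f 0 = f' 0) (h1 : g 0 = g' 0) :
    ∀ x ∈ Icc 0 X, f x = f' x ∧ g x = g' x := by
  intro x hx
  have := h.dist_le h' hq h0 h1 x hx
  rw [sub_self, norm_zero, zero_mul, zero_mul] at this
  have n1 := norm_nonneg (f x - f' x)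
  have n2 := norm_nonneg (g x - g' x)
  exact ⟨sub_eq_zero.1 (norm_le_zero_iff.1 (by linarith)),
    sub_eq_zero.1 (norm_le_zero_iff.1 (by linarith))⟩

end IsSystemSolution

theorem _root_.AbsolutelyContinuousOnInterval.congr {f g : ℝ → ℂ} {a b : ℝ}
    (hf : AbsolutelyContinuousOnInterval f a b) (h : EqOn f g (uIcc a b)) :
    AbsolutelyContinuousOnInterval g a b := by
  rw [absolutelyContinuousOnInterval_iff] at hf ⊢
  intro ε hε
  obtain ⟨δ, hδ, H⟩ := hf ε hε
  refine ⟨δ, hδ, fun E hE hlt => ?_⟩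
  refine lt_of_eq_of_lt (Finset.sum_congr rfl fun i hi => ?_) (H E hE hlt)
  have := hE.1 i hi
  rw [h this.1, h this.2]

theorem absolutelyContinuousOnInterval_primitive {f : ℝ → ℂ} {X : ℝ}
    (hf : IntervalIntegrable f volume 0 X) :
    AbsolutelyContinuousOnInterval (fun x => ∫ t in (0 : ℝ)..x, f t) 0 X := by
  have hre : IntervalIntegrable (fun t => (f t).re) volume 0 X := ⟨hf.1.re, hf.2.re⟩
  have him : IntervalIntegrable (fun t => (f t).im) volume 0 X := ⟨hf.1.im, hf.2.im⟩
  have hc : ∀ c : ℂ, AbsolutelyContinuousOnInterval (fun _ : ℝ => c) 0 X := fun c =>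
    (LipschitzOnWith.absolutelyContinuousOnInterval (K := 0)
      (LipschitzWith.const c).lipschitzOnWith)
  have h1 := (hre.absolutelyContinuousOnInterval_intervalIntegral (c := 0) (by simp)).fun_smul
    (hc 1)
  have h2 := (him.absolutelyContinuousOnInterval_intervalIntegral (c := 0) (by simp)).fun_smul
    (hc Complex.I)
  refine (h1.fun_add h2).congr fun x hx => ?_
  have hfx : IntervalIntegrable f volume 0 x :=
    hf.mono_set (uIcc_subset_uIcc left_mem_uIcc hx)
  have e1 := intervalIntegral.intervalIntegral_re hfx
  have e2 := intervalIntegral.intervalIntegral_im hfx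
  simp only [RCLike.re_to_complex, RCLike.im_to_complex] at e1 e2
  simp only [e1, e2, Complex.real_smul, mul_one, Complex.re_add_im]

/-- The Wronskian of two solutions at the same energy is constant. -/
theorem IsSystemSolution.wronskian_const {q : ℝ → ℝ} {z : ℂ} {X : ℝ} {f g f' g' : ℝ → ℂ}
    (h : IsSystemSolution q z X f g) (h' : IsSystemSolution q z X f' g')
    (hq : IntervalIntegrable q volume 0 X) :
    ∀ x ∈ Icc 0 X, f x * g' x - g x * f' x = f 0 * g' 0 - g 0 * f' 0 := by
  intro y hy
  have hX : 0 ≤ X := hy.1.trans hy.2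
  have hXX : X ∈ Icc 0 X := ⟨hX, le_rfl⟩
  have hc : ∀ c : ℂ, AbsolutelyContinuousOnInterval (fun _ : ℝ => c) 0 X := fun c =>
    (LipschitzOnWith.absolutelyContinuousOnInterval (K := 0)
      (LipschitzWith.const c).lipschitzOnWith)
  have i1 := h.intervalIntegrable_snd hXX
  have i2 := h.intervalIntegrable_potential_mul hXX hq z
  have i1' := h'.intervalIntegrable_snd hXX
  have i2' := h'.intervalIntegrable_potential_mul hXX hq z
  set F : ℝ → ℂ := fun x => f 0 + ∫ t in (0 : ℝ)..x, g t with hF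
  set G : ℝ → ℂ := fun x => g 0 + ∫ t in (0 : ℝ)..x, ((q t : ℂ) - z) * f t with hG
  set F' : ℝ → ℂ := fun x => f' 0 + ∫ t in (0 : ℝ)..x, g' t with hF'
  set G' : ℝ → ℂ := fun x => g' 0 + ∫ t in (0 : ℝ)..x, ((q t : ℂ) - z) * f' t with hG'
  have aF := (hc (f 0)).fun_add (absolutelyContinuousOnInterval_primitive i1)
  have aG := (hc (g 0)).fun_add (absolutelyContinuousOnInterval_primitive i2)
  have aF' := (hc (f' 0)).fun_add (absolutelyContinuousOnInterval_primitive i1')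
  have aG' := (hc (g' 0)).fun_add (absolutelyContinuousOnInterval_primitive i2')
  have aW := (aF.fun_smul aG').fun_sub (aG.fun_smul aF')
  have hder : ∀ᵐ x, x ∈ uIcc 0 X → HasDerivAt (fun x => F x * G' x - G x * F' x) 0 x := by
    filter_upwards [i1.ae_hasDerivAt_integral, i2.ae_hasDerivAt_integral,
      i1'.ae_hasDerivAt_integral, i2'.ae_hasDerivAt_integral] with x d1 d2 d1' d2' hx
    have e1 := (d1 hx 0 (by simp)).const_add (f 0)
    have e2 := (d2 hx 0 (by simp)).const_add (g 0)
    have e1' := (d1' hx 0 (by simp)).const_add (f' 0)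
    have e2' := (d2' hx 0 (by simp)).const_add (g' 0)
    have e := (e1.fun_mul e2').fun_sub (e2.fun_mul e1')
    rw [uIcc_of_le hX] at hx
    rw [← h.fst_eq x hx, ← h.snd_eq x hx, ← h'.fst_eq x hx, ← h'.snd_eq x hx] at e
    refine e.congr_deriv ?_
    ring
  obtain ⟨C, hC⟩ := AbsolutelyContinuousOnInterval.const_of_ae_hasDerivAt_zero aW hder
  rw [uIcc_of_le hX] at hC
  have h1 := hC y hy
  have h0 := hC 0 ⟨le_rfl, hX⟩
  simp only [smul_eq_mul] at h1 h0
  rw [← h.fst_eq y hy, ← h.snd_eq y hy, ← h'.fst_eq y hy, ← h'.snd_eq y hy] at h1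
  rw [h1, ← h0]
  simp

/-! ### Square-integrable solutions of eventually periodic equations -/

/-- The values of a square-integrable function along almost every translated lattice tend
to zero. -/
theorem ae_tendsto_zero_of_memLp {F : ℝ → ℂ} (hF : MemLp F 2 (volume.restrict (Ioi 0))) :
    ∀ᵐ s ∂(volume.restrict (Ioc (0 : ℝ) 1)),
      Tendsto (fun n : ℕ => F (s + n)) atTop (𝓝 0) := by
  set G : ℝ → ENNReal := fun x => ‖F x‖ₑ ^ 2 with hG
  have hGm : AEMeasurable G (volume.restrict (Ioi 0)) :=
    (hF.aestronglyMeasurable.enorm).pow_const 2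
  have hGfin : ∫⁻ x in Ioi 0, G x < ⊤ := by
    have := lintegral_rpow_enorm_lt_top_of_eLpNorm_lt_top (p := 2) (by norm_num) (by norm_num) hF.2
    simpa [hG] using this
  have hmp : ∀ n : ℕ, MeasurePreserving (fun s : ℝ => s + n) (volume.restrict (Ioc 0 1))
      (volume.restrict (Ioc (n : ℝ) (n + 1))) := by
    intro n
    have := (measurePreserving_add_right (volume : Measure ℝ) (n : ℝ)).restrict_preimage
      (measurableSet_Ioc (a := (n : ℝ)) (b := n + 1))
    convert this using 2
    ext x
    simp
  have hsub : ∀ n : ℕ, Ioc (n : ℝ) (n + 1) ⊆ Ioi 0 := fun n x hx =>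
    lt_of_le_of_lt (Nat.cast_nonneg n) hx.1
  have hGn : ∀ n : ℕ, AEMeasurable (fun s : ℝ => G (s + n)) (volume.restrict (Ioc 0 1)) :=
    fun n => by
      have h := AEMeasurable.comp_quasiMeasurePreserving (g := G)
        (hGm.mono_measure (Measure.restrict_mono (hsub n) le_rfl)) (hmp n).quasiMeasurePreserving
      exact h
  have hsum : ∫⁻ s in Ioc (0 : ℝ) 1, ∑' n : ℕ, G (s + n) < ⊤ := by
    rw [lintegral_tsum hGn]
    have h1 : ∀ n : ℕ, ∫⁻ s in Ioc (0 : ℝ) 1, G (s + n) = ∫⁻ x in Ioc (n : ℝ) (n + 1), G x :=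
      fun n => (hmp n).lintegral_comp_emb (measurableEmbedding_addRight (n : ℝ)) G
    simp_rw [h1]
    rw [← lintegral_iUnion (fun n => measurableSet_Ioc)]
    · refine (lintegral_mono_set (iUnion_subset hsub)).trans_lt hGfin
    · intro i j hij
      rw [Function.onFun, Set.disjoint_left]
      intro x hi hj
      apply hij
      have h1 : (i : ℝ) < j + 1 := hi.1.trans_le hj.2
      have h2 : (j : ℝ) < i + 1 := hj.1.trans_le hi.2
      norm_cast at h1 h2
      omega
  have hae := ae_lt_top' (AEMeasurable.tsum hGn) hsum.ne
  filter_upwards [hae] with s hs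
  have h0 := ENNReal.tendsto_atTop_zero_of_tsum_ne_top hs.ne
  rw [tendsto_zero_iff_enorm_tendsto_zero]
  have h2 := (ENNReal.continuous_rpow_const (y := 1 / 2)).tendsto 0 |>.comp h0
  rw [ENNReal.zero_rpow_of_pos (by norm_num)] at h2
  refine h2.congr fun n => ?_
  simp only [Function.comp, hG]
  rw [← ENNReal.rpow_natCast, ← ENNReal.rpow_mul]
  norm_num

/-- Beyond the point `N`, where `q` agrees with the periodic potential `V₀`, the translates of a
solution by integers solve the periodic equation. -/
theorem IsSolution.isSystemSolution_shift {q V₀ : ℝ → ℝ} {z : ℂ} {f : ℝ → ℂ} {N : ℕ}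
    (hf : IsSolution q z f) (hq : ∀ X, 0 ≤ X → IntervalIntegrable q volume 0 X)
    (hper : Function.Periodic V₀ 1) (hN : ∀ x, 0 < x → q (x + N) = V₀ x) (n : ℕ) {X : ℝ}
    (hX : 0 ≤ X) :
    IsSystemSolution V₀ z X (fun x => f (x + (N + n : ℕ)))
      (fun x => hderiv f (x + (N + n : ℕ))) := by
  have ha : (0 : ℝ) ≤ ((N + n : ℕ) : ℝ) := Nat.cast_nonneg _
  have hq' := hq (X + (N + n : ℕ)) (by positivity)
  have h := (hf.isSystemSolution (by positivity) hq').shift hq' ha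
  rw [add_sub_cancel_right] at h
  refine h.congr_potential fun x hx => ?_
  have : x + ((N + n : ℕ) : ℝ) = (x + n) + N := by push_cast; ring
  rw [this, hN _ (by have := hx.1; positivity)]
  simpa using hper.nat_mul n x

/-- Expansion of a solution in the Neumann and Dirichlet solutions. -/
theorem IsSystemSolution.eq_linear_combination {q : ℝ → ℝ} {z : ℂ} {X : ℝ} {f g v u : ℝ → ℂ}
    (hfg : IsSystemSolution q z X f g) (hX : 0 ≤ X) (hq : IntervalIntegrable q volume 0 X)
    (hv : IsNeumannSolution q z v) (hu : IsDirichletSolution q z u) :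
    ∀ x ∈ Icc 0 X, f x = f 0 * v x + g 0 * u x ∧ g x = f 0 * hderiv v x + g 0 * hderiv u x := by
  refine hfg.unique ((hv.isSolution.isSystemSolution hX hq).linear_combination
    (hu.isSolution.isSystemSolution hX hq) hq (f 0) (g 0)) hq ?_ ?_
  · simp [hv.zero, hu.zero]
  · simp [hv.hderiv_zero, hu.hderiv_zero]

/-- Two sampling points in a set of full measure at which evaluation determines a solution. -/
theorem exists_sampling_points {q : ℝ → ℝ} {z : ℂ} {v u : ℝ → ℂ}
    (hv : IsNeumannSolution q z v) (hu : IsDirichletSolution q z u) {P : ℝ → Prop}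
    (hP : ∀ᵐ s ∂(volume.restrict (Ioc (0 : ℝ) 1)), P s) :
    ∃ s₁ ∈ Icc (0 : ℝ) 1, ∃ s₂ ∈ Icc (0 : ℝ) 1, P s₁ ∧ P s₂ ∧
      v s₁ * u s₂ - v s₂ * u s₁ ≠ 0 := by
  have hvc : ContinuousOn v (Icc 0 1) :=
    hv.isSolution.differentiableOn.continuousOn.mono Icc_subset_Ici_self
  have huc : ContinuousOn u (Icc 0 1) :=
    hu.isSolution.differentiableOn.continuousOn.mono Icc_subset_Ici_self
  set A : Set ℝ := {s | s ∈ Icc (0 : ℝ) 1 ∧ P s} with hA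
  have hdense : Icc (0 : ℝ) 1 ⊆ closure A := by
    have h1 : Ioo (0 : ℝ) 1 ⊆ closure A := by
      intro x hx
      rw [mem_closure_iff_nhds]
      intro t ht
      rw [ae_restrict_iff' measurableSet_Ioc] at hP
      have hopen : t ∩ Ioo 0 1 ∈ 𝓝 x := inter_mem ht (Ioo_mem_nhds hx.1 hx.2)
      have hd : Dense {s : ℝ | s ∈ Ioc (0 : ℝ) 1 → P s} := Measure.dense_of_ae hP
      obtain ⟨y, hy1, hy2⟩ := hd.inter_nhds_nonempty hopen
      exact ⟨y, hy2.1, ⟨hy2.2.1.le, hy2.2.2.le⟩, hy1 ⟨hy2.2.1, hy2.2.2.le⟩⟩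
    have h2 := closure_minimal h1 isClosed_closure
    rwa [closure_Ioo (by norm_num)] at h2
  -- a function continuous on the unit interval and zero on `A` vanishes on the unit interval
  have hzero : ∀ F : ℝ → ℂ, ContinuousOn F (Icc 0 1) → (∀ s ∈ A, F s = 0) →
      ∀ s ∈ Icc (0 : ℝ) 1, F s = 0 := by
    intro F hF hFA s hs
    have h1 : ContinuousWithinAt F A s := (hF s hs).mono fun x hx => hx.1
    have := (h1.mem_closure (hdense hs) (t := {0}) fun x hx => hFA x hx)
    simpa using this
  by_contra! hcon
  have hu0 : ∀ s ∈ A, u s = 0 := by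
    intro s₂ h₂
    have h := hzero (fun s => v s * u s₂ - v s₂ * u s) (by fun_prop)
      (fun s hs => hcon s hs.1 s₂ h₂.1 hs.2 h₂.2) 0 (by simp)
    simpa [hv.zero, hu.zero] using h
  have hu1 := hzero u huc hu0
  have hd : HasDerivWithinAt u 1 (Icc 0 1) 0 := by
    have := hu.isSolution.hasDerivWithinAt (le_refl (0 : ℝ))
    rw [hu.hderiv_zero] at this
    exact this.mono Icc_subset_Ici_self
  have hd0 : HasDerivWithinAt u 0 (Icc 0 1) 0 :=
    (hasDerivWithinAt_const (0 : ℝ) (Icc (0 : ℝ) 1) (0 : ℂ)).congr hu1 (hu1 0 (by simp))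
  have := (uniqueDiffOn_Icc (zero_lt_one (α := ℝ)) 0 (by simp)).eq_deriv _ hd hd0
  exact one_ne_zero this

/-- For a square-integrable solution of an eventually periodic equation the Wronskian with its
translate by one period vanishes: it is constant, and both factors decay. -/
theorem wronskian_translate_eq_zero {q V₀ : ℝ → ℝ} {z : ℂ} {f : ℝ → ℂ} {N : ℕ}
    (hf : IsSolution q z f) (hq : ∀ X, 0 ≤ X → IntervalIntegrable q volume 0 X)
    (hV₀ : ∀ X, 0 ≤ X → IntervalIntegrable V₀ volume 0 X)
    (hper : Function.Periodic V₀ 1) (hN : ∀ x, 0 < x → q (x + N) = V₀ x)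
    (hL2 : MemLp f 2 (volume.restrict (Ioi 0))) :
    f N * hderiv f (N + 1) - hderiv f N * f (N + 1) = 0 := by
  have hsh := fun n X hX => hf.isSystemSolution_shift hq hper hN n (X := X) hX
  have hconst : ∀ n : ℕ, f (N + n : ℕ) * hderiv f (N + (n + 1) : ℕ) -
      hderiv f (N + n : ℕ) * f (N + (n + 1) : ℕ) =
      f N * hderiv f (N + 1) - hderiv f N * f (N + 1) := by
    intro n
    have h := (hsh 0 n n.cast_nonneg).wronskian_const (hsh 1 n n.cast_nonneg)
      (hV₀ n n.cast_nonneg) n ⟨n.cast_nonneg, le_rfl⟩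
    simp only [zero_add, Nat.add_zero, Nat.cast_add, Nat.cast_one] at h ⊢
    rw [show (N : ℝ) + n = n + N by ring, show (N : ℝ) + (n + 1) = n + (N + 1) by ring]
    exact h
  obtain ⟨v, hv0, hv1, hv2⟩ := exists_isSolution hV₀ z 1 0
  obtain ⟨u, hu0, hu1, hu2⟩ := exists_isSolution hV₀ z 0 1
  have hv : IsNeumannSolution V₀ z v := ⟨hv0, hv1, hv2⟩
  have hu : IsDirichletSolution V₀ z u := ⟨hu0, hu1, hu2⟩
  obtain ⟨s₁, hs₁, s₂, hs₂, t₁, t₂, hne⟩ :=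
    exists_sampling_points hv hu (ae_tendsto_zero_of_memLp hL2)
  have hexp : ∀ s ∈ Icc (0 : ℝ) 1, ∀ n : ℕ, f (s + (N + n : ℕ)) =
      f (N + n : ℕ) * v s + hderiv f (N + n : ℕ) * u s := by
    intro s hs n
    have := ((hsh n 1 zero_le_one).eq_linear_combination zero_le_one (hV₀ 1 zero_le_one) hv hu
      s hs).1
    simpa only [zero_add] using this
  have hshift : ∀ s, Tendsto (fun n : ℕ => f (s + n)) atTop (𝓝 0) →
      Tendsto (fun n : ℕ => f (s + (N + n : ℕ))) atTop (𝓝 0) := fun s hs => by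
    have := hs.comp (tendsto_add_atTop_nat N)
    refine this.congr fun n => ?_
    simp [add_comm]
  replace t₁ := hshift s₁ t₁
  replace t₂ := hshift s₂ t₂
  have hf0 : Tendsto (fun n : ℕ => f (N + n : ℕ)) atTop (𝓝 0) := by
    have := ((t₁.mul_const (u s₂)).sub (t₂.mul_const (u s₁))).div_const (v s₁ * u s₂ - v s₂ * u s₁)
    simp only [zero_mul, sub_zero, zero_div] at this
    refine this.congr fun n => ?_
    rw [hexp s₁ hs₁ n, hexp s₂ hs₂ n, div_eq_iff hne]
    ring
  have hg0 : Tendsto (fun n : ℕ => hderiv f (N + n : ℕ)) atTop (𝓝 0) := by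
    have := ((t₂.mul_const (v s₁)).sub (t₁.mul_const (v s₂))).div_const (v s₁ * u s₂ - v s₂ * u s₁)
    simp only [zero_mul, sub_zero, zero_div] at this
    refine this.congr fun n => ?_
    rw [hexp s₁ hs₁ n, hexp s₂ hs₂ n, div_eq_iff hne]
    ring
  have hf1 := hf0.comp (tendsto_add_atTop_nat 1)
  have hg1 := hg0.comp (tendsto_add_atTop_nat 1)
  have hlim := (hf0.mul hg1).sub (hg0.mul hf1)
  simp only [mul_zero, sub_zero] at hlim
  have h2 := hlim.congr fun n => hconst n
  exact tendsto_nhds_unique tendsto_const_nhds h2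

/-! ### Continuity in the energy and Floquet solutions -/

/-- Roots in the closed upper half-plane of quadratic polynomials whose coefficients converge to
those of a polynomial with a pair of non-real conjugate roots converge to the root in the open
upper half-plane. -/
theorem tendsto_root_of_tendsto_coeff {ι : Type*} {l : Filter ι} {a b c m : ι → ℂ}
    {a₀ b₀ c₀ A m₀ : ℂ} (ha : Tendsto a l (𝓝 a₀)) (hb : Tendsto b l (𝓝 b₀))
    (hc : Tendsto c l (𝓝 c₀)) (hroot : ∀ᶠ i in l, a i * m i ^ 2 + b i * m i + c i = 0)
    (him : ∀ᶠ i in l, 0 ≤ (m i).im)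
    (hfac : ∀ x, a₀ * x ^ 2 + b₀ * x + c₀ = A * ((x - m₀) * (x - conj m₀))) (hA : A ≠ 0)
    (hm₀ : 0 < m₀.im) : Tendsto m l (𝓝 m₀) := by
  -- `K` is such that `1 + ‖m‖ ≤ K ‖m - conj m₀‖` in the closed upper half-plane
  set K : ℝ := (1 + ‖m₀‖) / m₀.im + 1 with hK
  set η : ι → ℝ := fun i => (‖a₀ - a i‖ + ‖b₀ - b i‖ + ‖c₀ - c i‖) * (K ^ 2 / ‖A‖) with hη
  have hA' : 0 < ‖A‖ := norm_pos_iff.2 hA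
  have hη0 : Tendsto η l (𝓝 0) := by
    have h := ((((tendsto_const_nhds (x := a₀)).sub ha).norm.add
      ((tendsto_const_nhds (x := b₀)).sub hb).norm).add
      ((tendsto_const_nhds (x := c₀)).sub hc).norm).mul_const (K ^ 2 / ‖A‖)
    simpa using h
  have hlt : ∀ᶠ i in l, η i < 1 / 2 := hη0.eventually_lt_const (by norm_num)
  rw [tendsto_iff_norm_sub_tendsto_zero]
  have hlim : Tendsto (fun i => 2 * η i * ‖m₀ - conj m₀‖) l (𝓝 0) := by
    have := (hη0.const_mul 2).mul_const ‖m₀ - conj m₀‖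
    simpa using this
  refine squeeze_zero' (Eventually.of_forall fun i => norm_nonneg _) ?_ hlim
  filter_upwards [hroot, him, hlt] with i hr hi hlt
  set D : ℝ := ‖m i - conj m₀‖ with hD
  have hDim : m₀.im ≤ D := by
    have h := Complex.abs_im_le_norm (m i - conj m₀)
    simp only [Complex.sub_im, Complex.conj_im, sub_neg_eq_add] at h
    rw [abs_of_nonneg (by linarith)] at h
    linarith
  have hmK : 1 + ‖m i‖ ≤ K * D := by
    have h1 : ‖m i‖ ≤ D + ‖m₀‖ := by
      have := norm_add_le (m i - conj m₀) (conj m₀)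
      rwa [sub_add_cancel, Complex.norm_conj] at this
    have h2 : (1 + ‖m₀‖) ≤ (1 + ‖m₀‖) / m₀.im * D := by
      rw [div_mul_eq_mul_div, le_div_iff₀ hm₀]
      exact mul_le_mul_of_nonneg_left hDim (by positivity)
    rw [hK, add_mul, one_mul]
    linarith
  have hDpos : 0 < D := hm₀.trans_le hDim
  have heq : A * ((m i - m₀) * (m i - conj m₀)) =
      (a₀ - a i) * m i ^ 2 + (b₀ - b i) * m i + (c₀ - c i) := by
    rw [← hfac]; linear_combination hr
  have hnorm : ‖A‖ * (‖m i - m₀‖ * D) ≤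
      (‖a₀ - a i‖ + ‖b₀ - b i‖ + ‖c₀ - c i‖) * (1 + ‖m i‖) ^ 2 := by
    have h1 : ‖A‖ * (‖m i - m₀‖ * D) = ‖A * ((m i - m₀) * (m i - conj m₀))‖ := by
      rw [norm_mul, norm_mul]
    rw [h1, heq]
    refine (norm_add₃_le).trans ?_
    rw [norm_mul, norm_mul, norm_pow]
    have n1 := norm_nonneg (a₀ - a i)
    have n2 := norm_nonneg (b₀ - b i)
    have n3 := norm_nonneg (c₀ - c i)
    have n4 := norm_nonneg (m i)
    nlinarith [mul_nonneg n1 n4, mul_nonneg n2 n4, mul_nonneg n3 n4,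
      mul_nonneg n2 (mul_nonneg n4 n4),
      mul_nonneg n3 (mul_nonneg n4 n4)]
  have hsq : (1 + ‖m i‖) ^ 2 ≤ (K * D) ^ 2 := by gcongr
  have h3 : ‖m i - m₀‖ ≤ η i * D := by
    have h4 : ‖A‖ * (‖m i - m₀‖ * D) ≤
        (‖a₀ - a i‖ + ‖b₀ - b i‖ + ‖c₀ - c i‖) * (K * D) ^ 2 :=
      hnorm.trans (mul_le_mul_of_nonneg_left hsq (by positivity))
    have h5 : ‖A‖ * (η i * D) * D = (‖a₀ - a i‖ + ‖b₀ - b i‖ + ‖c₀ - c i‖) * (K * D) ^ 2 := by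
      simp only [hη]; field_simp
    have h6 : ‖m i - m₀‖ * (‖A‖ * D) ≤ (η i * D) * (‖A‖ * D) := by linarith
    exact le_of_mul_le_mul_right h6 (by positivity)
  have h7 : D ≤ ‖m i - m₀‖ + ‖m₀ - conj m₀‖ := by
    have := norm_add_le (m i - m₀) (m₀ - conj m₀)
    rwa [sub_add_sub_cancel] at this
  have hη_nonneg : 0 ≤ η i := by simp only [hη]; positivity
  nlinarith [mul_le_mul_of_nonneg_left h7 hη_nonneg, norm_nonneg (m i - m₀)]

/-- Solutions with fixed initial values depend continuously on the energy. -/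
theorem tendsto_solution {q : ℝ → ℝ} (hq : ∀ X, 0 ≤ X → IntervalIntegrable q volume 0 X)
    {f : ℂ → ℝ → ℂ} {α β : ℂ} (hf : ∀ z, IsSolution q z (f z)) (h0 : ∀ z, f z 0 = α)
    (h1 : ∀ z, hderiv (f z) 0 = β) {x : ℝ} (hx : 0 ≤ x) (w : ℂ) :
    Tendsto (fun z => f z x) (𝓝 w) (𝓝 (f w x)) ∧
      Tendsto (fun z => hderiv (f z) x) (𝓝 w) (𝓝 (hderiv (f w) x)) := by
  set M : ℝ := (∫ t in (0 : ℝ)..x, ‖f w t‖) *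
    Real.exp (∫ t in (0 : ℝ)..x, ((1 + ‖(q t : ℂ) - w‖) + 1)) with hM
  have hbd : ∀ᶠ z in 𝓝 w, ‖f z x - f w x‖ + ‖hderiv (f z) x - hderiv (f w) x‖ ≤ ‖z - w‖ * M := by
    filter_upwards [Metric.closedBall_mem_nhds w one_pos] with z hz
    have h := ((hf z).isSystemSolution hx (hq x hx)).dist_le
      ((hf w).isSystemSolution hx (hq x hx)) (hq x hx) ((h0 z).trans (h0 w).symm)
      ((h1 z).trans (h1 w).symm) x ⟨hx, le_rfl⟩
    refine h.trans ?_
    rw [hM, mul_assoc]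
    have hI : ∫ t in (0 : ℝ)..x, (1 + ‖(q t : ℂ) - z‖) ≤
        ∫ t in (0 : ℝ)..x, ((1 + ‖(q t : ℂ) - w‖) + 1) := by
      refine intervalIntegral.integral_mono_on hx (intervalIntegrable_weight z (hq x hx))
        ((intervalIntegrable_weight w (hq x hx)).add intervalIntegrable_const) fun t _ => ?_
      have h2 := norm_sub_le_norm_sub_add_norm_sub (q t : ℂ) w z
      rw [Metric.mem_closedBall, dist_comm, dist_eq_norm] at hz
      linarith
    have hnn : 0 ≤ ∫ t in (0 : ℝ)..x, ‖f w t‖ :=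
      intervalIntegral.integral_nonneg hx fun t _ => norm_nonneg _
    gcongr
  have hlim : Tendsto (fun z => ‖z - w‖ * M) (𝓝 w) (𝓝 0) := by
    have h : Tendsto (fun z : ℂ => ‖z - w‖) (𝓝 w) (𝓝 0) :=
      tendsto_iff_norm_sub_tendsto_zero.1 tendsto_id
    simpa using h.mul_const M
  constructor
  · rw [tendsto_iff_norm_sub_tendsto_zero]
    exact squeeze_zero' (Eventually.of_forall fun z => norm_nonneg _)
      (hbd.mono fun z hz => (le_add_of_nonneg_right (norm_nonneg _)).trans hz) hlim
  · rw [tendsto_iff_norm_sub_tendsto_zero]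
    exact squeeze_zero' (Eventually.of_forall fun z => norm_nonneg _)
      (hbd.mono fun z hz => (le_add_of_nonneg_left (norm_nonneg _)).trans hz) hlim

theorem hderiv_conj {u : ℝ → ℂ} {x : ℝ} (hu : DifferentiableOn ℝ u (Ici 0)) (hx : 0 ≤ x) :
    hderiv (fun t => conj (u t)) x = conj (hderiv u x) :=
  hderiv_eq_of_hasDerivWithinAt hx
    (Complex.conjCLE.hasFDerivAt.comp_hasDerivWithinAt x (hu x hx).hasDerivWithinAt)

theorem IsFloquetSolution.exists_wronskian {V₀ : ℝ → ℝ} {E : ℝ} {φ : ℝ → ℂ}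
    (hφ : IsFloquetSolution V₀ E φ) :
    ∃ ω : ℝ, 0 < ω ∧ ‖wronskian (fun t => conj (φ t)) φ 0‖ = ω ∧
      ∀ x, 0 ≤ x → conj (φ x) * hderiv φ x - conj (hderiv φ x) * φ x = Complex.I * ω := by
  obtain ⟨ω, hω, h⟩ := hφ.wronskian_eq
  refine ⟨ω, hω, ?_, fun x hx => ?_⟩
  · rw [h 0 le_rfl, norm_mul, Complex.norm_I, one_mul, Complex.norm_real, Real.norm_of_nonneg hω.le]
  · rw [← h x hx, wronskian, hderiv_conj hφ.isSolution.differentiableOn hx]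

/-- Inside a band the Floquet multiplier is not real. -/
theorem IsFloquetSolution.exists_multiplier {V₀ : ℝ → ℝ} {E : ℝ} {φ : ℝ → ℂ}
    (hφ : IsFloquetSolution V₀ E φ) (hV₀ : ∀ X, 0 ≤ X → IntervalIntegrable V₀ volume 0 X)
    (hE : E ∈ bands V₀) :
    ∃ κ : ℂ, κ - conj κ ≠ 0 ∧ (∀ x, 0 ≤ x → φ (x + 1) = κ * φ x) ∧
      ∀ x, 0 ≤ x → hderiv φ (x + 1) = κ * hderiv φ x := by
  obtain ⟨k, J, hJ, hφJ⟩ := hφ.floquet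
  obtain ⟨ω, hω, -, hW⟩ := hφ.exists_wronskian
  obtain ⟨v, u, hv, hu, htr⟩ := hE
  set κ : ℂ := Complex.exp (Complex.I * k) with hκ
  have hκκ : κ * conj κ = 1 := by
    rw [hκ, ← Complex.exp_conj, ← Complex.exp_add]
    simp
  have h1 : ∀ x, 0 ≤ x → φ (x + 1) = κ * φ x := by
    intro x hx
    rw [hφJ x hx, hφJ (x + 1) (by linarith), hJ x, hκ]
    push_cast
    rw [mul_add, mul_one, Complex.exp_add]
    ring
  have h2 : ∀ x, 0 ≤ x → hderiv φ (x + 1) = κ * hderiv φ x := by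
    intro x hx
    have d1 : HasDerivWithinAt (fun t => φ (t + 1)) (hderiv φ (x + 1)) (Ici 0) x := by
      have := (hφ.isSolution.hasDerivWithinAt (show (0 : ℝ) ≤ x + 1 by linarith)).scomp x
        (((hasDerivAt_id x).add_const 1).hasDerivWithinAt (s := Ici 0))
        (fun t (ht : 0 ≤ t) => show (0 : ℝ) ≤ t + 1 by linarith)
      simpa [Function.comp_def] using this
    have d2 : HasDerivWithinAt (fun t => φ (t + 1)) (κ * hderiv φ x) (Ici 0) x :=
      ((hφ.isSolution.hasDerivWithinAt hx).const_mul κ).congr (fun t ht => h1 t ht) (h1 x hx)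
    exact (uniqueDiffOn_Ici (0 : ℝ) x hx).eq_deriv _ d1 d2
  refine ⟨κ, ?_, h1, h2⟩
  intro hreal
  have hI := hV₀ 1 zero_le_one
  have hexp := (hφ.isSolution.isSystemSolution zero_le_one hI).eq_linear_combination zero_le_one hI
    hv hu 1 (by simp)
  have hdet := (hv.isSolution.isSystemSolution zero_le_one hI).wronskian_const
    (hu.isSolution.isSystemSolution zero_le_one hI) hI 1 (by simp)
  rw [hv.zero, hv.hderiv_zero, hu.zero, hu.hderiv_zero] at hdet
  have e1 := h1 0 le_rfl
  have e2 := h2 0 le_rfl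
  rw [zero_add] at e1 e2
  rw [e1, e2] at hexp
  obtain ⟨x1, x2⟩ := hexp
  -- `κ` is an eigenvalue of the transfer matrix, which has determinant one
  have hchar : (v 1 - κ) * (hderiv u 1 - κ) - u 1 * hderiv v 1 = 0 := by
    by_contra hne
    have p1 : ((v 1 - κ) * (hderiv u 1 - κ) - u 1 * hderiv v 1) * φ 0 = 0 := by
      linear_combination (-(hderiv u 1 - κ)) * x1 + u 1 * x2
    have p2 : ((v 1 - κ) * (hderiv u 1 - κ) - u 1 * hderiv v 1) * hderiv φ 0 = 0 := by
      linear_combination hderiv v 1 * x1 - (v 1 - κ) * x2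
    have q1 := (mul_eq_zero.1 p1).resolve_left hne
    have q2 := (mul_eq_zero.1 p2).resolve_left hne
    have := hW 0 le_rfl
    rw [q1, q2] at this
    simp only [map_zero, mul_zero, sub_zero] at this
    exact (mul_ne_zero Complex.I_ne_zero (by exact_mod_cast hω.ne')) this.symm
  have hκsq : κ * κ = 1 := by
    have : conj κ = κ := (sub_eq_zero.1 hreal).symm
    rwa [this] at hκκ
  have htr2 : κ * (v 1 + hderiv u 1) = 2 := by
    linear_combination hκsq - hchar + hdet
  have hn : ‖κ‖ = 1 := by
    have : ‖κ‖ * ‖κ‖ = 1 := by rw [← norm_mul, hκsq, norm_one]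
    nlinarith [norm_nonneg κ]
  have : ‖κ * (v 1 + hderiv u 1)‖ = 2 := by rw [htr2]; simp
  rw [norm_mul, hn, one_mul] at this
  linarith

/-! ### Boundary values on the bands -/

theorem intervalIntegrable_of_periodic {V₀ : ℝ → ℝ} (hper : Function.Periodic V₀ 1)
    (hint : IntegrableOn V₀ (Icc 0 1) volume) (X : ℝ) : IntervalIntegrable V₀ volume 0 X := by
  have h : IntervalIntegrable V₀ volume 0 (0 + 1) := by
    rw [zero_add]
    exact (intervalIntegrable_iff_integrableOn_Icc_of_le zero_le_one).2 hint
  exact hper.intervalIntegrable one_ne_zero h 0 X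

theorem intervalIntegrable_of_locallyIntegrableOn {V : ℝ → ℝ}
    (hV : LocallyIntegrableOn V (Ici 0) volume) {X : ℝ} (hX : 0 ≤ X) :
    IntervalIntegrable V volume 0 X :=
  (intervalIntegrable_iff_integrableOn_Icc_of_le hX).2
    (hV.integrableOn_compact_subset Icc_subset_Ici_self isCompact_Icc)

theorem intervalIntegrable_cutoff {V : ℝ → ℝ} (hV : LocallyIntegrableOn V (Ici 0) volume)
    (L : ℝ) {X : ℝ} (hX : 0 ≤ X) : IntervalIntegrable (cutoff V L) volume 0 X := by
  have h := intervalIntegrable_of_locallyIntegrableOn hV hX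
  rw [intervalIntegrable_iff] at h ⊢
  exact h.indicator measurableSet_Icc

/-- At an energy in a band, the Wronskian at `N` of a solution `v + m u` of the cut-off equation
and its translate by one period is a quadratic polynomial in `m` with the roots `m₀` and `conj m₀`,
where `v + m₀ u` is a multiple of the Floquet solution to the right of `L`. -/
theorem exists_boundary_value {V₀ V : ℝ → ℝ} (hper : Function.Periodic V₀ 1)
    (hint : IntegrableOn V₀ (Icc 0 1) volume) (hV : LocallyIntegrableOn V (Ici 0) volume)
    {L : ℝ} (hL : 0 < L) {N : ℕ} (hN : L < N) {E : ℝ} (hE : E ∈ bands V₀) {φ U ρ v u : ℝ → ℂ}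
    (hφ : IsFloquetSolution V₀ E φ)
    (hU : IsDirichletSolution (fun x => V₀ x + V x) (E : ℂ) U) (hρ : IsPrufer φ U ρ)
    (hv : IsNeumannSolution (fun x => V₀ x + cutoff V L x) (E : ℂ) v)
    (hu : IsDirichletSolution (fun x => V₀ x + cutoff V L x) (E : ℂ) u) :
    ∃ A m₀ : ℂ, A ≠ 0 ∧
      m₀.im = 2 / (‖wronskian (fun t => conj (φ t)) φ 0‖ * ‖ρ L‖ ^ 2) ∧ 0 < m₀.im ∧
      ∀ m : ℂ, (v N + m * u N) * (hderiv v (N + 1) + m * hderiv u (N + 1)) -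
        (hderiv v N + m * hderiv u N) * (v (N + 1) + m * u (N + 1)) =
          A * ((m - m₀) * (m - conj m₀)) := by
  obtain ⟨ω, hω, hωn, hW⟩ := hφ.exists_wronskian
  have hV₀ := intervalIntegrable_of_periodic hper hint
  obtain ⟨κ, hκne, hκφ, hκφ'⟩ := hφ.exists_multiplier (fun X _ => hV₀ X) hE
  have hq : ∀ X, 0 ≤ X → IntervalIntegrable (fun x => V₀ x + cutoff V L x) volume 0 X :=
    fun X hX => (hV₀ X).add (intervalIntegrable_cutoff hV L hX)
  have hQ : ∀ X, 0 ≤ X → IntervalIntegrable (fun x => V₀ x + V x) volume 0 X :=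
    fun X hX => (hV₀ X).add (intervalIntegrable_of_locallyIntegrableOn hV hX)
  set X : ℝ := N + 1 with hX
  have hX0 : 0 ≤ X := by positivity
  have hLX : L ≤ X := by linarith
  have sv := hv.isSolution.isSystemSolution hX0 (hq X hX0)
  have su := hu.isSolution.isSystemSolution hX0 (hq X hX0)
  have sφ := hφ.isSolution.isSystemSolution hX0 (hV₀ X)
  have hLmem : L ∈ Icc 0 X := ⟨hL.le, hLX⟩
  -- the Dirichlet solutions with and without cutoff agree up to `L`
  obtain ⟨uL, uL'⟩ : u L = U L ∧ hderiv u L = hderiv U L := by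
    refine (hu.isSolution.isSystemSolution hL.le (hq L hL.le)).unique
      ((hU.isSolution.isSystemSolution hL.le (hQ L hL.le)).congr_potential fun x hx => ?_)
      (hq L hL.le) (hu.zero.trans hU.zero.symm) (hu.hderiv_zero.trans hU.hderiv_zero.symm) L
      ⟨hL.le, le_rfl⟩
    simp [cutoff, indicator_of_mem (show x ∈ Icc 0 L from ⟨hx.1.le, hx.2⟩)]
  have hWvu : v L * hderiv u L - hderiv v L * u L = 1 := by
    rw [sv.wronskian_const su (hq X hX0) L hLmem, hv.zero, hv.hderiv_zero, hu.zero, hu.hderiv_zero]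
    simp
  set r : ℂ := ρ L with hr
  have hI := Complex.I_ne_zero
  have hI2 := Complex.I_sq
  rw [hρ.value L hL.le] at uL
  rw [hρ.hderiv_value L hL.le] at uL'
  have hr0 : r ≠ 0 := by
    intro h0
    rw [← hr, h0] at uL uL'
    simp only [map_zero, zero_mul, sub_zero, mul_zero] at uL uL'
    rw [uL, uL'] at hWvu
    simp at hWvu
  have hrc0 : conj r ≠ 0 := (map_ne_zero _).2 hr0
  have hω0 : (ω : ℂ) ≠ 0 := by exact_mod_cast hω.ne'
  -- the multiple of the Floquet solution whose Wronskian with `u` at `L` is one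
  set c : ℂ := 2 / (ω * conj r) with hc
  have hcr : c * (conj r * ω) = 2 := by rw [hc]; field_simp
  have hcr' : conj c * (r * ω) = 2 := by
    have h := congrArg conj hcr
    simpa only [map_mul, Complex.conj_conj, Complex.conj_ofReal, Complex.conj_ofNat] using h
  have hWL := hW L hL.le
  have hWcu : c * φ L * hderiv u L - c * hderiv φ L * u L = 1 := by
    rw [uL, uL']
    have : (1 / (2 * Complex.I)) * 2 * Complex.I = 1 := by field_simp
    linear_combination (c * conj r * (1 / (2 * Complex.I))) * hWL +
      (Complex.I * (1 / (2 * Complex.I))) * hcr + this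
  set m₀ : ℂ := v L * (c * hderiv φ L) - hderiv v L * (c * φ L) with hm₀
  have eL : v L + m₀ * u L = c * φ L := by
    rw [hm₀]; linear_combination c * φ L * hWvu - v L * hWcu
  have eL' : hderiv v L + m₀ * hderiv u L = c * hderiv φ L := by
    rw [hm₀]; linear_combination c * hderiv φ L * hWvu - hderiv v L * hWcu
  -- beyond `L` both solutions are combinations of the Floquet solution and its conjugate
  have hXL : 0 ≤ X - L := by linarith
  have hpot : ∀ x ∈ Ioc 0 (X - L), V₀ (x + L) + cutoff V L (x + L) = V₀ (x + L) := by
    intro x hx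
    have : x + L ∉ Icc 0 L := fun h => by linarith [h.2, hx.1]
    simp [cutoff, this]
  have tv := (sv.shift (hq X hX0) hL.le).congr_potential hpot
  have tu := (su.shift (hq X hX0) hL.le).congr_potential hpot
  have tφ := sφ.shift (hV₀ X) hL.le
  have hVs : IntervalIntegrable (fun x => V₀ (x + L)) volume 0 (X - L) := by
    have h : IntervalIntegrable V₀ volume L X := (hV₀ L).symm.trans (hV₀ X)
    have := h.comp_add_right L
    rwa [sub_self] at this
  have uval : ∀ x, L ≤ x → x ≤ X →
      u x = 1 / (2 * Complex.I) * r * φ x + -(1 / (2 * Complex.I) * conj r) * conj (φ x) ∧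
      hderiv u x = 1 / (2 * Complex.I) * r * hderiv φ x +
        -(1 / (2 * Complex.I) * conj r) * conj (hderiv φ x) := by
    intro x hx hxX
    have h := tu.unique (tφ.linear_combination tφ.star hVs (1 / (2 * Complex.I) * r)
      (-(1 / (2 * Complex.I) * conj r))) hVs (by simp only [zero_add]; rw [uL]; ring)
      (by simp only [zero_add]; rw [uL']; ring) (x - L) ⟨by linarith, by linarith⟩
    simpa only [sub_add_cancel] using h
  have vval : ∀ x, L ≤ x → x ≤ X → v x + m₀ * u x = c * φ x ∧
      hderiv v x + m₀ * hderiv u x = c * hderiv φ x := by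
    intro x hx hxX
    have h := (tv.linear_combination tu hVs 1 m₀).unique
      (tφ.linear_combination tφ hVs c 0) hVs (by simp only [zero_add]; rw [one_mul, eL]; ring)
      (by simp only [zero_add]; rw [one_mul, eL']; ring) (x - L) ⟨by linarith, by linarith⟩
    simpa only [sub_add_cancel, one_mul, zero_mul, add_zero] using h
  -- the imaginary part of `m₀` from the Wronskian of `conj (v + m₀ u)` and `v + m₀ u`
  have hcc : c * conj c * (r * conj r * ω) * ω = 4 := by
    linear_combination (conj c * (r * ω)) * hcr + 2 * hcr'
  have him : m₀ - conj m₀ = c * conj c * (Complex.I * ω) := by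
    have sf := sv.linear_combination su (hq X hX0) 1 m₀
    have h := sf.star.wronskian_const sf (hq X hX0) L hLmem
    simp only [one_mul, eL, eL', hv.zero, hu.zero, hv.hderiv_zero, hu.hderiv_zero] at h
    simp only [map_mul, mul_zero, add_zero, mul_one, zero_add, map_one, one_mul] at h
    rw [← h, ← hWL]; ring
  have hrr : r * conj r = ((‖r‖ ^ 2 : ℝ) : ℂ) := by
    rw [Complex.mul_conj, Complex.normSq_eq_norm_sq]
  have hrn : 0 < ‖r‖ := norm_pos_iff.2 hr0
  have hmim : m₀.im = 2 / (ω * ‖r‖ ^ 2) := by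
    have h1 : m₀ - conj m₀ = ((2 * m₀.im : ℝ) : ℂ) * Complex.I := Complex.sub_conj m₀
    have h2 : ((2 * m₀.im : ℝ) : ℂ) * ((‖r‖ ^ 2 : ℝ) : ℂ) * ω = 4 := by
      have h3 : ((2 * m₀.im : ℝ) : ℂ) = c * conj c * ω := by
        apply mul_right_cancel₀ hI
        rw [← h1, him]; ring
      rw [h3, ← hrr]; linear_combination hcc
    have h4 : 2 * m₀.im * ‖r‖ ^ 2 * ω = 4 := by exact_mod_cast h2
    rw [eq_div_iff (by positivity)]
    linarith
  refine ⟨(r * conj r) / 4 * ((κ - conj κ) * (Complex.I * ω)), m₀, ?_, ?_, ?_, ?_⟩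
  · exact mul_ne_zero (div_ne_zero (mul_ne_zero hr0 hrc0) (by norm_num))
      (mul_ne_zero hκne (mul_ne_zero hI hω0))
  · rw [hωn, hmim]
  · rw [hmim]; positivity
  · intro m
    have hNL : L ≤ (N : ℝ) := hN.le
    have hNX : (N : ℝ) ≤ X := by rw [hX]; linarith
    have hN0 : (0 : ℝ) ≤ N := Nat.cast_nonneg N
    obtain ⟨u1, u1'⟩ := uval N hNL hNX
    obtain ⟨u2, u2'⟩ := uval X hLX le_rfl
    obtain ⟨v1, v1'⟩ := vval N hNL hNX
    obtain ⟨v2, v2'⟩ := vval X hLX le_rfl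
    have k1 := hκφ N hN0
    have k1' := hκφ' N hN0
    rw [← hX] at k1 k1'
    rw [k1] at u2 v2
    rw [k1'] at u2' v2'
    rw [map_mul] at u2 u2'
    have w := hW N hN0
    set s : ℂ := m - m₀ with hs
    set j : ℂ := 1 / (2 * Complex.I) with hj
    set α : ℂ := c + s * (j * r) with hα
    set β : ℂ := -(s * (j * conj r)) with hβ
    have f1 : v N + m * u N = α * φ N + β * conj (φ N) := by
      rw [hα, hβ]; linear_combination v1 + s * u1
    have f1' : hderiv v N + m * hderiv u N = α * hderiv φ N + β * conj (hderiv φ N) := by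
      rw [hα, hβ]; linear_combination v1' + s * u1'
    have f2 : v X + m * u X = α * (κ * φ N) + β * (conj κ * conj (φ N)) := by
      rw [hα, hβ]; linear_combination v2 + s * u2
    have f2' : hderiv v X + m * hderiv u X =
        α * (κ * hderiv φ N) + β * (conj κ * conj (hderiv φ N)) := by
      rw [hα, hβ]; linear_combination v2' + s * u2'
    rw [f1, f1', f2, f2']
    have hαβ : α * β = r * conj r / 4 * (s * (m - conj m₀)) := by
      have h1 : m - conj m₀ = s + c * conj c * (Complex.I * ω) := by rw [hs, ← him]; ring
      have hjj : j = -Complex.I / 2 := by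
        rw [hj]; field_simp; rw [hI2]; norm_num
      rw [h1, hα, hβ, hjj]
      linear_combination (-(s ^ 2 * r * conj r) / 4) * hI2 - (conj r * s * c * Complex.I / 4) * hcr'
    rw [← mul_assoc, mul_comm _ (s * (m - conj m₀))]
    linear_combination (κ - conj κ) * (α * β) * w + (κ - conj κ) * (Complex.I * ω) * hαβ

/-- The union of the open bands is open, by continuity of the trace of the transfer matrix. -/
theorem isOpen_bands {V₀ : ℝ → ℝ} (hV₀ : ∀ X, 0 ≤ X → IntervalIntegrable V₀ volume 0 X) :
    IsOpen (bands V₀) := by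
  choose v hv0 hv1 hv2 using fun z : ℂ => exists_isSolution hV₀ z 1 0
  choose u hu0 hu1 hu2 using fun z : ℂ => exists_isSolution hV₀ z 0 1
  have hcont : Continuous fun E : ℝ => ‖v E 1 + hderiv (u E) 1‖ := by
    refine Continuous.norm (Continuous.add ?_ ?_)
    · have h : Continuous fun z : ℂ => v z 1 := continuous_iff_continuousAt.2 fun z =>
        (tendsto_solution hV₀ hv0 hv1 hv2 zero_le_one z).1
      exact h.comp Complex.continuous_ofReal
    · have h : Continuous fun z : ℂ => hderiv (u z) 1 := continuous_iff_continuousAt.2 fun z =>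
        (tendsto_solution hV₀ hu0 hu1 hu2 zero_le_one z).2
      exact h.comp Complex.continuous_ofReal
  have heq : bands V₀ = {E : ℝ | ‖v E 1 + hderiv (u E) 1‖ < 2} := by
    ext E
    constructor
    · rintro ⟨v', u', hv', hu', h⟩
      have hI := hV₀ 1 zero_le_one
      have e1 := ((hv0 E).isSystemSolution zero_le_one hI).unique
        (hv'.isSolution.isSystemSolution zero_le_one hI) hI ((hv1 E).trans hv'.zero.symm)
        ((hv2 E).trans hv'.hderiv_zero.symm) 1 (by simp)
      have e2 := ((hu0 E).isSystemSolution zero_le_one hI).unique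
        (hu'.isSolution.isSystemSolution zero_le_one hI) hI ((hu1 E).trans hu'.zero.symm)
        ((hu2 E).trans hu'.hderiv_zero.symm) 1 (by simp)
      simpa only [mem_ofPred_eq, e1.1, e2.2] using h
    · intro h
      exact ⟨v E, u E, ⟨hv0 E, hv1 E, hv2 E⟩, ⟨hu0 E, hu1 E, hu2 E⟩, h⟩
  rw [heq]
  exact isOpen_lt hcont continuous_const

theorem isSolution_linear_combination {q : ℝ → ℝ} {z : ℂ} {v u : ℝ → ℂ}
    (hq : ∀ X, 0 ≤ X → IntervalIntegrable q volume 0 X) (hv : IsSolution q z v)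
    (hu : IsSolution q z u) (m : ℂ) :
    IsSolution q z (fun x => v x + m * u x) ∧
      ∀ x, 0 ≤ x → hderiv (fun x => v x + m * u x) x = hderiv v x + m * hderiv u x := by
  have h : ∀ X, 0 ≤ X → IsSystemSolution q z X (fun x => v x + m * u x)
      (fun x => hderiv v x + m * hderiv u x) := fun X hX => by
    simpa only [one_mul] using (hv.isSystemSolution hX (hq X hX)).linear_combination
      (hu.isSystemSolution hX (hq X hX)) (hq X hX) 1 m
  exact isSolution_of_integral_eq (fun X hX => (h X hX).continuousOn_snd)
    (fun x hx => (h x hx).fst_eq x ⟨hx, le_rfl⟩) (fun x hx => (h x hx).snd_eq x ⟨hx, le_rfl⟩)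

/-- The `m`-function of the cut-off operator has boundary values on the bands, with imaginary part
expressed by the generalized Prüfer amplitude at `L`. -/
theorem exists_tendsto_weylM {V₀ V : ℝ → ℝ} (hper : Function.Periodic V₀ 1)
    (hint : IntegrableOn V₀ (Icc 0 1) volume) (hV : LocallyIntegrableOn V (Ici 0) volume)
    {L : ℝ} (hL : 0 < L) {E : ℝ} (hE : E ∈ bands V₀) {φ U ρ : ℝ → ℂ}
    (hφ : IsFloquetSolution V₀ E φ)
    (hU : IsDirichletSolution (fun x => V₀ x + V x) (E : ℂ) U) (hρ : IsPrufer φ U ρ)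
    {M : ℂ → ℂ} (hM : ∀ z, 0 < z.im → IsWeylM (fun x => V₀ x + cutoff V L x) z (M z))
    (hMim : ∀ z, 0 < z.im → 0 ≤ (M z).im) :
    ∃ m₀ : ℂ, m₀.im = 2 / (‖wronskian (fun t => conj (φ t)) φ 0‖ * ‖ρ L‖ ^ 2) ∧
      Tendsto M (𝓝[{z | 0 < z.im}] (E : ℂ)) (𝓝 m₀) := by
  obtain ⟨N, hN⟩ := exists_nat_gt L
  set q : ℝ → ℝ := fun x => V₀ x + cutoff V L x with hqdef
  have hV₀ := intervalIntegrable_of_periodic hper hint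
  have hq : ∀ X, 0 ≤ X → IntervalIntegrable q volume 0 X :=
    fun X hX => (hV₀ X).add (intervalIntegrable_cutoff hV L hX)
  have hqN : ∀ x, 0 < x → q (x + N) = V₀ x := by
    intro x hx
    have h1 : x + N ∉ Icc 0 L := fun h => by linarith [h.2]
    have h2 : V₀ (x + N) = V₀ x := by simpa using hper.nat_mul N x
    simp [hqdef, cutoff, h1, h2]
  choose v hv0 hv1 hv2 using fun z : ℂ => exists_isSolution hq z 1 0
  choose u hu0 hu1 hu2 using fun z : ℂ => exists_isSolution hq z 0 1
  obtain ⟨A, m₀, hA, him, hpos, hfac⟩ := exists_boundary_value hper hint hV hL hN hE hφ hU hρ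
    (v := v E) (u := u E) ⟨hv0 E, hv1 E, hv2 E⟩ ⟨hu0 E, hu1 E, hu2 E⟩
  refine ⟨m₀, him, ?_⟩
  have hN0 : (0 : ℝ) ≤ N := Nat.cast_nonneg N
  have hN1 : (0 : ℝ) ≤ (N : ℝ) + 1 := by positivity
  have tv := fun x hx => tendsto_solution hq hv0 hv1 hv2 (x := x) hx (E : ℂ)
  have tu := fun x hx => tendsto_solution hq hu0 hu1 hu2 (x := x) hx (E : ℂ)
  -- the coefficients of the quadratic equation for `M z`
  set a : ℂ → ℂ := fun z => u z N * hderiv (u z) (N + 1) - hderiv (u z) N * u z (N + 1) with ha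
  set b : ℂ → ℂ := fun z => v z N * hderiv (u z) (N + 1) - hderiv (v z) N * u z (N + 1) +
    (u z N * hderiv (v z) (N + 1) - hderiv (u z) N * v z (N + 1)) with hb
  set c : ℂ → ℂ := fun z => v z N * hderiv (v z) (N + 1) - hderiv (v z) N * v z (N + 1) with hc
  have ta : Tendsto a (𝓝 (E : ℂ)) (𝓝 (a E)) :=
    ((tu _ hN0).1.mul (tu _ hN1).2).sub ((tu _ hN0).2.mul (tu _ hN1).1)
  have tb : Tendsto b (𝓝 (E : ℂ)) (𝓝 (b E)) :=
    (((tv _ hN0).1.mul (tu _ hN1).2).sub ((tv _ hN0).2.mul (tu _ hN1).1)).add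
      (((tu _ hN0).1.mul (tv _ hN1).2).sub ((tu _ hN0).2.mul (tv _ hN1).1))
  have tc : Tendsto c (𝓝 (E : ℂ)) (𝓝 (c E)) :=
    ((tv _ hN0).1.mul (tv _ hN1).2).sub ((tv _ hN0).2.mul (tv _ hN1).1)
  have hev : ∀ᶠ z in 𝓝[{z : ℂ | 0 < z.im}] (E : ℂ), 0 < z.im := eventually_mem_nhdsWithin
  refine tendsto_root_of_tendsto_coeff (ta.mono_left nhdsWithin_le_nhds)
    (tb.mono_left nhdsWithin_le_nhds) (tc.mono_left nhdsWithin_le_nhds)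
    (hev.mono fun z hz => ?_) (hev.mono hMim) (fun x => ?_) hA hpos
  · obtain ⟨v', u', hv', hu', hL2, -⟩ := hM z hz
    have ev : ∀ x, 0 ≤ x → v' x = v z x := fun x hx =>
      ((hv'.isSolution.isSystemSolution hx (hq x hx)).unique
        ((hv0 z).isSystemSolution hx (hq x hx)) (hq x hx) (hv'.zero.trans (hv1 z).symm)
        (hv'.hderiv_zero.trans (hv2 z).symm) x ⟨hx, le_rfl⟩).1
    have eu : ∀ x, 0 ≤ x → u' x = u z x := fun x hx =>
      ((hu'.isSolution.isSystemSolution hx (hq x hx)).unique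
        ((hu0 z).isSystemSolution hx (hq x hx)) (hq x hx) (hu'.zero.trans (hu1 z).symm)
        (hu'.hderiv_zero.trans (hu2 z).symm) x ⟨hx, le_rfl⟩).1
    have hL2' : MemLp (fun x => v z x + M z * u z x) 2 (volume.restrict (Ioi 0)) := by
      refine hL2.ae_eq ?_
      filter_upwards [ae_restrict_mem measurableSet_Ioi] with x hx
      rw [ev x (le_of_lt hx), eu x (le_of_lt hx)]
    obtain ⟨hsol, hd⟩ := isSolution_linear_combination hq (hv0 z) (hu0 z) (M z)
    have h := wronskian_translate_eq_zero hsol hq (fun X _ => hV₀ X) hper hqN hL2'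
    rw [hd _ hN0, hd _ hN1] at h
    simp only [ha, hb, hc]
    linear_combination h
  · rw [← hfac x]
    simp only [ha, hb, hc]
    ring

/-! ### Poisson integrals and Stieltjes inversion -/

/-- The Poisson integral (up to the factor `1 / π`) of a measure on the real line at `x + i ε`. -/
noncomputable def poissonIntegral (μ : Measure ℝ) (x ε : ℝ) : ℝ :=
  ∫ t, ε / ((t - x) ^ 2 + ε ^ 2) ∂μ

theorem isLocallyFiniteMeasure_of_integrable {μ : Measure ℝ}
    (hμ : Integrable (fun x : ℝ => 1 / (1 + x ^ 2)) μ) : IsLocallyFiniteMeasure μ := by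
  refine ⟨fun x => ⟨Metric.ball x 1, Metric.ball_mem_nhds x one_pos, ?_⟩⟩
  have hpos : (0 : ℝ) < 1 / (1 + (|x| + 1) ^ 2) := by positivity
  refine lt_of_le_of_lt (measure_mono ?_) (hμ.measure_norm_ge_lt_top hpos)
  intro y hy
  rw [Metric.mem_ball, Real.dist_eq] at hy
  have h1 : |y| ≤ |x| + 1 := by
    have := abs_sub_abs_le_abs_sub y x
    linarith
  have h2 : y ^ 2 ≤ (|x| + 1) ^ 2 := by
    rw [← sq_abs y]; gcongr
  rw [mem_ofPred_eq, Real.norm_of_nonneg (by positivity)]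
  gcongr

/-- Domination of the Poisson kernel by the integrable function `1 / (1 + t²)`, uniformly for `x` in
`[-K, K]`. -/
theorem poissonKernel_le {K x ε : ℝ} (hx : |x| ≤ K) (hε : 0 < ε) (t : ℝ) :
    ε / ((t - x) ^ 2 + ε ^ 2) ≤ (2 * ε + (1 + 2 * K ^ 2) / ε) * (1 / (1 + t ^ 2)) := by
  have hx2 : x ^ 2 ≤ K ^ 2 := by rw [← sq_abs x]; gcongr
  rw [mul_one_div, div_le_div_iff₀ (by positivity) (by positivity)]
  have h1 : 1 + t ^ 2 ≤ 2 * (t - x) ^ 2 + (1 + 2 * K ^ 2) := by nlinarith [sq_nonneg (t - 2 * x)]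
  have h2 : (2 * ε + (1 + 2 * K ^ 2) / ε) * ((t - x) ^ 2 + ε ^ 2) =
      ε * (2 * (t - x) ^ 2 + (1 + 2 * K ^ 2)) + 2 * ε * ε ^ 2 +
        (1 + 2 * K ^ 2) / ε * (t - x) ^ 2 := by
    field_simp; ring
  rw [h2]
  have h3 : 0 ≤ 2 * ε * ε ^ 2 + (1 + 2 * K ^ 2) / ε * (t - x) ^ 2 := by positivity
  nlinarith

theorem continuous_poissonKernel {ε : ℝ} (hε : 0 < ε) :
    Continuous fun p : ℝ × ℝ => ε / ((p.2 - p.1) ^ 2 + ε ^ 2) :=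
  continuous_const.div (by fun_prop) fun p => by positivity

theorem integrable_poissonKernel {μ : Measure ℝ}
    (hμ : Integrable (fun x : ℝ => 1 / (1 + x ^ 2)) μ) (x : ℝ) {ε : ℝ} (hε : 0 < ε) :
    Integrable (fun t => ε / ((t - x) ^ 2 + ε ^ 2)) μ := by
  refine (hμ.const_mul (2 * ε + (1 + 2 * |x| ^ 2) / ε)).mono'
    ((continuous_poissonKernel hε).comp (by fun_prop : Continuous fun t : ℝ => (x, t))
      |>.aestronglyMeasurable) (Eventually.of_forall fun t => ?_)
  rw [Real.norm_of_nonneg (by positivity)]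
  exact poissonKernel_le le_rfl hε t

/-- The imaginary part of a Herglotz integral in the upper half-plane is a Poisson integral. -/
theorem im_herglotz {μ : Measure ℝ} (hμ : Integrable (fun x : ℝ => 1 / (1 + x ^ 2)) μ) (C : ℝ)
    {z : ℂ} (hz : 0 < z.im) :
    ((C : ℂ) + ∫ x : ℝ, (1 / ((x : ℂ) - z) - (x : ℂ) / (1 + (x : ℂ) ^ 2)) ∂μ).im =
      poissonIntegral μ z.re z.im := by
  have hne : ∀ x : ℝ, (x : ℂ) - z ≠ 0 := fun x h => by
    have := congrArg Complex.im h
    simp at this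
    exact hz.ne' this
  have hne2 : ∀ x : ℝ, (1 : ℂ) + (x : ℂ) ^ 2 ≠ 0 := fun x => by
    have : (1 : ℝ) + x ^ 2 ≠ 0 := by positivity
    exact_mod_cast this
  have hint : Integrable (fun x : ℝ => 1 / ((x : ℂ) - z) - (x : ℂ) / (1 + (x : ℂ) ^ 2)) μ := by
    refine (hμ.const_mul (‖1 + z ^ 2‖ / z.im + ‖z‖)).mono' ?_ (Eventually.of_forall fun x => ?_)
    · refine Continuous.aestronglyMeasurable ?_
      exact (continuous_const.div (by fun_prop) hne).sub
        (Complex.continuous_ofReal.div (by fun_prop) hne2)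
    · have e1 : 1 / ((x : ℂ) - z) - (x : ℂ) / (1 + (x : ℂ) ^ 2) =
          ((1 + z ^ 2) / (x - z) + z) * (1 / (1 + (x : ℂ) ^ 2)) := by
        have := hne x; have := hne2 x
        field_simp; ring
      have e2 : ‖(1 : ℂ) / (1 + (x : ℂ) ^ 2)‖ = 1 / (1 + x ^ 2) := by
        have : (1 : ℂ) / (1 + (x : ℂ) ^ 2) = ((1 / (1 + x ^ 2) : ℝ) : ℂ) := by push_cast; rfl
        rw [this, Complex.norm_real, Real.norm_of_nonneg (by positivity)]
      have e3 : z.im ≤ ‖(x : ℂ) - z‖ := by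
        have := Complex.abs_im_le_norm ((x : ℂ) - z)
        simpa [abs_of_pos hz] using this
      rw [e1, norm_mul, e2]
      refine mul_le_mul_of_nonneg_right ((norm_add_le _ _).trans ?_) (by positivity)
      rw [norm_div]
      gcongr
  rw [Complex.add_im, Complex.ofReal_im, zero_add, poissonIntegral]
  have h := integral_im hint
  simp only [RCLike.im_to_complex] at h
  rw [← h]
  refine integral_congr_ae (Eventually.of_forall fun x => ?_)
  have e : ((x : ℂ) / (1 + (x : ℂ) ^ 2)).im = 0 := by
    have : (x : ℂ) / (1 + (x : ℂ) ^ 2) = ((x / (1 + x ^ 2) : ℝ) : ℂ) := by push_cast; rfl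
    rw [this, Complex.ofReal_im]
  simp only [Complex.sub_im, e, one_div, Complex.inv_im, Complex.normSq_apply, Complex.ofReal_im,
    Complex.sub_re, Complex.ofReal_re, zero_sub, sub_zero, neg_neg]
  congr 1
  ring

theorem poissonIntegral_nonneg (μ : Measure ℝ) (x : ℝ) {ε : ℝ} (hε : 0 < ε) :
    0 ≤ poissonIntegral μ x ε :=
  integral_nonneg fun t => by positivity

theorem integral_poissonKernel (a b t : ℝ) {ε : ℝ} (hε : 0 < ε) :
    ∫ x in a..b, ε / ((t - x) ^ 2 + ε ^ 2) =
      Real.arctan ((b - t) / ε) - Real.arctan ((a - t) / ε) := by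
  refine intervalIntegral.integral_eq_sub_of_hasDerivAt
    (f := fun x => Real.arctan ((x - t) / ε)) (fun x _ => ?_) ?_
  · have h := ((((hasDerivAt_id x).sub_const t).div_const ε).arctan)
    refine h.congr_deriv ?_
    simp only [id]
    field_simp
    ring
  · exact ((continuous_poissonKernel hε).comp
      (by fun_prop : Continuous fun x : ℝ => (x, t))).intervalIntegrable _ _

/-- The integral of the Poisson integral over an interval, by Fubini's theorem. -/
theorem integral_poissonIntegral {μ : Measure ℝ}
    (hμ : Integrable (fun x : ℝ => 1 / (1 + x ^ 2)) μ) {a b : ℝ} (hab : a ≤ b) {ε : ℝ}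
    (hε : 0 < ε) :
    ∫ x in a..b, poissonIntegral μ x ε =
      ∫ t, (Real.arctan ((b - t) / ε) - Real.arctan ((a - t) / ε)) ∂μ := by
  have := isLocallyFiniteMeasure_of_integrable hμ
  simp_rw [← integral_poissonKernel a b _ hε, poissonIntegral, intervalIntegral.integral_of_le hab]
  refine integral_integral_swap ?_
  set K := max |a| |b|
  have hdom : Integrable (fun p : ℝ × ℝ => (2 * ε + (1 + 2 * K ^ 2) / ε) * (1 / (1 + p.2 ^ 2)))
      ((volume.restrict (Ioc a b)).prod μ) := (hμ.const_mul _).comp_snd _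
  refine hdom.mono' (continuous_poissonKernel hε).aestronglyMeasurable ?_
  have hmem : ∀ᵐ p ∂((volume.restrict (Ioc a b)).prod μ), p.1 ∈ Ioc a b :=
    Measure.quasiMeasurePreserving_fst.ae (ae_restrict_mem measurableSet_Ioc)
  filter_upwards [hmem] with p hp
  simp only [Function.uncurry]
  rw [Real.norm_of_nonneg (by positivity)]
  exact poissonKernel_le (abs_le_max_abs_abs hp.1.le hp.2) hε p.2

/-- A bound for the integrated Poisson kernel that is uniform in `ε`. -/
theorem norm_arctan_sub_arctan_le {K a b ε : ℝ} (hK : 1 ≤ K) (ha : |a| ≤ K) (hb : |b| ≤ K)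
    (hab : a ≤ b) (hε : 0 < ε) (hε1 : ε ≤ 1) (t : ℝ) :
    ‖Real.arctan ((b - t) / ε) - Real.arctan ((a - t) / ε)‖ ≤
      (Real.pi * (1 + 4 * K ^ 2) + 16 * K) * (1 / (1 + t ^ 2)) := by
  have hpi := Real.pi_pos
  rcases le_total |t| (2 * K) with ht | ht
  · have h1 : ‖Real.arctan ((b - t) / ε) - Real.arctan ((a - t) / ε)‖ ≤ Real.pi := by
      rw [Real.norm_eq_abs, abs_le]
      constructor <;>
      linarith [Real.arctan_lt_pi_div_two ((b - t) / ε),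
        Real.neg_pi_div_two_lt_arctan ((b - t) / ε),
        Real.arctan_lt_pi_div_two ((a - t) / ε), Real.neg_pi_div_two_lt_arctan ((a - t) / ε)]
    refine h1.trans ?_
    rw [mul_one_div, le_div_iff₀ (by positivity)]
    have ht2 : t ^ 2 ≤ (2 * K) ^ 2 := by rw [← sq_abs t]; gcongr
    nlinarith
  · rw [← integral_poissonKernel a b t hε]
    have h1 : ∀ x ∈ uIoc a b, ‖ε / ((t - x) ^ 2 + ε ^ 2)‖ ≤ 8 * (1 / (1 + t ^ 2)) := by
      intro x hx
      rw [uIoc_of_le hab] at hx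
      have hxK : |x| ≤ K := (abs_le_max_abs_abs hx.1.le hx.2).trans (max_le ha hb)
      have h2 : |t| / 2 ≤ |t - x| := by
        have := abs_sub_abs_le_abs_sub t x
        linarith
      have h3 : (|t| / 2) ^ 2 ≤ |t - x| ^ 2 := by gcongr
      rw [sq_abs, div_pow, sq_abs] at h3
      have h4 : 1 ≤ t ^ 2 := by rw [← sq_abs t]; nlinarith
      rw [Real.norm_of_nonneg (by positivity), mul_one_div, div_le_div_iff₀ (by positivity)
        (by positivity)]
      nlinarith [sq_nonneg ε]
    refine (intervalIntegral.norm_integral_le_of_norm_le_const h1).trans ?_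
    rw [abs_of_nonneg (by linarith), mul_right_comm]
    refine mul_le_mul_of_nonneg_right ?_ (by positivity)
    have := (abs_le.1 ha).1
    have := (abs_le.1 hb).2
    nlinarith [sq_nonneg K]

/-- As `ε` tends to zero, the integrated Poisson kernel tends to `π` times the indicator of the
interval, away from the endpoints. -/
theorem tendsto_arctan_sub_arctan {a b t : ℝ} (hab : a ≤ b) (hta : t ≠ a) (htb : t ≠ b) :
    Tendsto (fun ε => Real.arctan ((b - t) / ε) - Real.arctan ((a - t) / ε)) (𝓝[>] 0)
      (𝓝 ((Ioc a b).indicator (fun _ => Real.pi) t)) := by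
  have hpos : ∀ c : ℝ, 0 < c → Tendsto (fun ε : ℝ => Real.arctan (c / ε)) (𝓝[>] 0)
      (𝓝 (Real.pi / 2)) := fun c hc => by
    have h1 : Tendsto (fun ε : ℝ => c / ε) (𝓝[>] 0) atTop := by
      simpa only [div_eq_mul_inv] using tendsto_inv_nhdsGT_zero.const_mul_atTop hc
    exact (tendsto_nhds_of_tendsto_nhdsWithin Real.tendsto_arctan_atTop).comp h1
  have hneg : ∀ c : ℝ, c < 0 → Tendsto (fun ε : ℝ => Real.arctan (c / ε)) (𝓝[>] 0)
      (𝓝 (-(Real.pi / 2))) := fun c hc => by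
    have h := (hpos (-c) (by linarith)).neg
    refine h.congr fun ε => ?_
    rw [← Real.arctan_neg, neg_div, neg_neg]
  rcases lt_or_gt_of_ne hta with h1 | h1
  · have h := (hpos (b - t) (by linarith)).sub (hpos (a - t) (by linarith))
    rw [indicator_of_notMem (fun h' => by linarith [h'.1])]
    simpa using h
  · rcases lt_or_gt_of_ne htb with h2 | h2
    · have h := (hpos (b - t) (by linarith)).sub (hneg (a - t) (by linarith))
      rw [indicator_of_mem (show t ∈ Ioc a b from ⟨h1, h2.le⟩)]
      simpa using h
    · have h := (hneg (b - t) (by linarith)).sub (hneg (a - t) (by linarith))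
      rw [indicator_of_notMem (fun h' => by linarith [h'.2])]
      simpa using h

/-- Points at which the Poisson integral has a finite vertical limit carry no mass. -/
theorem measure_singleton_eq_zero {μ : Measure ℝ}
    (hμ : Integrable (fun x : ℝ => 1 / (1 + x ^ 2)) μ) {E γ : ℝ}
    (h : Tendsto (fun ε => poissonIntegral μ E ε) (𝓝[>] 0) (𝓝 γ)) : μ {E} = 0 := by
  have := isLocallyFiniteMeasure_of_integrable hμ
  have hfin : μ {E} ≠ ⊤ := isCompact_singleton.measure_lt_top.ne
  have hle : ∀ᶠ ε in 𝓝[>] (0 : ℝ), μ.real {E} ≤ ε * poissonIntegral μ E ε := by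
    filter_upwards [self_mem_nhdsWithin] with ε (hε : 0 < ε)
    have h1 : ∫ t in {E}, ε / ((t - E) ^ 2 + ε ^ 2) ∂μ ≤ poissonIntegral μ E ε :=
      setIntegral_le_integral (integrable_poissonKernel hμ E hε)
        (Eventually.of_forall fun t => by positivity)
    rw [integral_singleton, sub_self, smul_eq_mul] at h1
    have h2 : ε * (μ.real {E} * (ε / (0 ^ 2 + ε ^ 2))) = μ.real {E} := by field_simp; ring
    rw [← h2]
    exact mul_le_mul_of_nonneg_left h1 hε.le
  have hlim : Tendsto (fun ε => ε * poissonIntegral μ E ε) (𝓝[>] 0) (𝓝 (0 * γ)) :=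
    (tendsto_nhds_of_tendsto_nhdsWithin tendsto_id).mul h
  rw [zero_mul] at hlim
  have h0 : μ.real {E} ≤ 0 := ge_of_tendsto hlim hle
  have h1 : μ.real {E} = 0 := le_antisymm h0 measureReal_nonneg
  exact (measureReal_eq_zero_iff hfin).1 h1

section StieltjesInversion

variable {μ : Measure ℝ} {S : Set ℝ} {γ : ℝ → ℝ}

theorem continuousAt_boundary_value (hS : IsOpen S)
    (h : ∀ E ∈ S, Tendsto (fun p : ℝ × ℝ => poissonIntegral μ p.1 p.2) (𝓝 E ×ˢ 𝓝[>] 0) (𝓝 (γ E)))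
    {E : ℝ} (hE : E ∈ S) : ContinuousAt γ E := by
  rw [ContinuousAt, (closed_nhds_basis (γ E)).tendsto_right_iff]
  rintro W ⟨hW, hWc⟩
  have h1 := ((h E hE).eventually_mem hW).curry
  filter_upwards [h1, hS.mem_nhds hE] with x hx hxS
  have h2 : Tendsto (fun ε => poissonIntegral μ x ε) (𝓝[>] 0) (𝓝 (γ x)) :=
    (h x hxS).comp (tendsto_const_nhds.prodMk tendsto_id)
  exact hWc.mem_of_tendsto h2 hx

/-- Stieltjes inversion: if the Poisson integral of `μ` has boundary values `γ` on an open set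
(with unrestricted approach from the upper half-plane), then `μ` has the density `γ / π` there. -/
theorem pi_mul_measureReal_Ioc (hμ : Integrable (fun x : ℝ => 1 / (1 + x ^ 2)) μ)
    (h : ∀ E ∈ S, Tendsto (fun p : ℝ × ℝ => poissonIntegral μ p.1 p.2) (𝓝 E ×ˢ 𝓝[>] 0) (𝓝 (γ E)))
    {a b : ℝ} (hab : a ≤ b) (hsub : Icc a b ⊆ S) :
    Real.pi * μ.real (Ioc a b) = ∫ x in a..b, γ x := by
  have := isLocallyFiniteMeasure_of_integrable hμ
  have hvert : ∀ x ∈ S, Tendsto (fun ε => poissonIntegral μ x ε) (𝓝[>] 0) (𝓝 (γ x)) := fun x hx =>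
    (h x hx).comp (tendsto_const_nhds.prodMk tendsto_id)
  -- the Poisson integral is uniformly bounded above the interval
  obtain ⟨M, hM⟩ : ∃ M : ℝ, ∀ᶠ ε in 𝓝[>] (0 : ℝ), ∀ x ∈ Icc a b, poissonIntegral μ x ε ≤ M := by
    refine isCompact_Icc.induction_on (p := fun s => ∃ M : ℝ, ∀ᶠ ε in 𝓝[>] (0 : ℝ), ∀ x ∈ s,
      poissonIntegral μ x ε ≤ M) ⟨0, by simp⟩ ?_ ?_ ?_
    · rintro s t hst ⟨M, hM⟩
      exact ⟨M, hM.mono fun ε hε x hx => hε x (hst hx)⟩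
    · rintro s t ⟨M, hM⟩ ⟨M', hM'⟩
      refine ⟨max M M', ?_⟩
      filter_upwards [hM, hM'] with ε h1 h2 x hx
      rcases hx with hx | hx
      · exact (h1 x hx).trans (le_max_left _ _)
      · exact (h2 x hx).trans (le_max_right _ _)
    · intro x hx
      have h1 : ∀ᶠ p in 𝓝 x ×ˢ 𝓝[>] (0 : ℝ), poissonIntegral μ p.1 p.2 < γ x + 1 :=
        (h x (hsub hx)).eventually_lt_const (by linarith)
      obtain ⟨pa, ha, pb, hb, hp⟩ := eventually_prod_iff.1 h1
      exact ⟨{y | pa y}, mem_nhdsWithin_of_mem_nhds ha, γ x + 1,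
        hb.mono fun ε hε y hy => (hp hy hε).le⟩
  have hleft : Tendsto (fun ε => ∫ x in a..b, poissonIntegral μ x ε) (𝓝[>] 0)
      (𝓝 (∫ x in a..b, γ x)) := by
    refine intervalIntegral.tendsto_integral_filter_of_dominated_convergence (fun _ => M) ?_ ?_
      intervalIntegrable_const (Eventually.of_forall fun x hx => ?_)
    · filter_upwards [self_mem_nhdsWithin] with ε (hε : 0 < ε)
      exact ((continuous_poissonKernel hε).stronglyMeasurable.integral_prod_right
        (ν := μ)).aestronglyMeasurable
    · filter_upwards [hM, self_mem_nhdsWithin] with ε hε (hε0 : 0 < ε)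
      refine Eventually.of_forall fun x hx => ?_
      rw [uIoc_of_le hab] at hx
      rw [Real.norm_of_nonneg (poissonIntegral_nonneg μ x hε0)]
      exact hε x ⟨hx.1.le, hx.2⟩
    · rw [uIoc_of_le hab] at hx
      exact hvert x (hsub ⟨hx.1.le, hx.2⟩)
  have hright : Tendsto (fun ε => ∫ t, (Real.arctan ((b - t) / ε) - Real.arctan ((a - t) / ε)) ∂μ)
      (𝓝[>] 0) (𝓝 (∫ t, (Ioc a b).indicator (fun _ => Real.pi) t ∂μ)) := by
    set K : ℝ := max 1 (max |a| |b|) with hK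
    refine tendsto_integral_filter_of_dominated_convergence
      (fun t => (Real.pi * (1 + 4 * K ^ 2) + 16 * K) * (1 / (1 + t ^ 2))) ?_ ?_
      (hμ.const_mul _) ?_
    · refine Eventually.of_forall fun ε => Continuous.aestronglyMeasurable ?_
      exact (Real.continuous_arctan.comp (by fun_prop)).sub
        (Real.continuous_arctan.comp (by fun_prop))
    · filter_upwards [self_mem_nhdsWithin, Ioo_mem_nhdsGT (zero_lt_one' ℝ)] with ε (hε : 0 < ε) hε1
      exact Eventually.of_forall fun t => norm_arctan_sub_arctan_le (le_max_left _ _)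
        ((le_max_left _ _).trans (le_max_right _ _)) ((le_max_right _ _).trans (le_max_right _ _))
        hab hε hε1.2.le t
    · have ha : ∀ᵐ t ∂μ, t ≠ a := by
        have := measure_singleton_eq_zero hμ (hvert a (hsub ⟨le_rfl, hab⟩))
        rw [ae_iff]; simpa using this
      have hb : ∀ᵐ t ∂μ, t ≠ b := by
        have := measure_singleton_eq_zero hμ (hvert b (hsub ⟨hab, le_rfl⟩))
        rw [ae_iff]; simpa using this
      filter_upwards [ha, hb] with t hta htb
      exact tendsto_arctan_sub_arctan hab hta htb
  rw [integral_indicator measurableSet_Ioc, setIntegral_const, smul_eq_mul, mul_comm] at hright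
  refine tendsto_nhds_unique (hright.congr' ?_) hleft
  filter_upwards [self_mem_nhdsWithin] with ε (hε : 0 < ε)
  exact (integral_poissonIntegral hμ hab hε).symm

end StieltjesInversion

/-! ### Density and distribution function -/

section Density

variable {μ : Measure ℝ} {S : Set ℝ} {d : ℝ → ℝ}

/-- A measure with a continuous density with respect to intervals contained in an open set has that
density on the open set. -/
theorem restrict_eq_withDensity_of_Ioc [IsLocallyFiniteMeasure μ] (hS : IsOpen S)
    (hd : ∀ E ∈ S, ContinuousAt d E)
    (hd0 : ∀ E ∈ S, 0 ≤ d E)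
    (h : ∀ a b, a ≤ b → Icc a b ⊆ S → μ.real (Ioc a b) = ∫ x in a..b, d x) :
    μ.restrict S = (volume.restrict S).withDensity fun E => ENNReal.ofReal (d E) := by
  set ν : Measure ℝ := volume.withDensity fun E => ENNReal.ofReal (d E) with hν
  have hIoc : ∀ a b, a ≤ b → Icc a b ⊆ S → μ (Ioc a b) = ν (Ioc a b) := by
    intro a b hab hsub
    have hcont : ContinuousOn d (Icc a b) := fun x hx => (hd x (hsub hx)).continuousWithinAt
    have hfin : μ (Ioc a b) ≠ ⊤ :=
      ((measure_mono Ioc_subset_Icc_self).trans_lt isCompact_Icc.measure_lt_top).ne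
    rw [hν, withDensity_apply _ measurableSet_Ioc, ← ofReal_integral_eq_lintegral_ofReal,
      ← intervalIntegral.integral_of_le hab, ← h a b hab hsub, measureReal_def,
      ENNReal.ofReal_toReal hfin]
    · exact hcont.integrableOn_Icc.mono_set Ioc_subset_Icc_self
    · filter_upwards [ae_restrict_mem measurableSet_Ioc] with x hx
      exact hd0 x (hsub ⟨hx.1.le, hx.2⟩)
  have hIocr : ∀ a b, Icc a b ⊆ S → μ.restrict (Ioc a b) = ν.restrict (Ioc a b) := by
    intro p q hpq
    have hfin : IsFiniteMeasure (μ.restrict (Ioc p q)) :=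
      ⟨by
        rw [Measure.restrict_apply_univ]
        exact (measure_mono Ioc_subset_Icc_self).trans_lt isCompact_Icc.measure_lt_top⟩
    refine Measure.ext_of_Ioc _ _ fun a b _ => ?_
    rw [Measure.restrict_apply measurableSet_Ioc, Measure.restrict_apply measurableSet_Ioc,
      Ioc_inter_Ioc]
    rcases le_total (a ⊔ p) (b ⊓ q) with hle | hle
    · exact hIoc _ _ hle ((Icc_subset_Icc le_sup_right inf_le_right).trans hpq)
    · rw [Ioc_eq_empty (not_lt.2 hle), measure_empty, measure_empty]
  -- `S` is a countable union of intervals with rational endpoints whose closure is in `S`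
  have hcover : S = ⋃ i : {p : ℚ × ℚ // Icc (p.1 : ℝ) p.2 ⊆ S}, Ioc (i.1.1 : ℝ) i.1.2 := by
    ext x
    simp only [mem_iUnion]
    constructor
    · intro hx
      obtain ⟨l, r, hlr, hsub⟩ := mem_nhds_iff_exists_Ioo_subset.1 (hS.mem_nhds hx)
      obtain ⟨p, hp1, hp2⟩ := exists_rat_btwn hlr.1
      obtain ⟨q, hq1, hq2⟩ := exists_rat_btwn hlr.2
      exact ⟨⟨(p, q), fun y hy => hsub ⟨hp1.trans_le hy.1, hy.2.trans_lt hq2⟩⟩, hp2, hq1.le⟩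
    · rintro ⟨i, hi⟩
      exact i.2 ⟨hi.1.le, hi.2⟩
  have hres : μ.restrict S = ν.restrict S := by
    rw [hcover]
    exact Measure.restrict_iUnion_congr.2 fun i => hIocr _ _ i.2
  rw [hres, hν, restrict_withDensity hS.measurableSet]

/-- The distribution function of a measure with a continuous density is differentiable. -/
theorem hasDerivAt_measureReal_Ioc (hS : IsOpen S) (hd : ∀ E ∈ S, ContinuousAt d E)
    (h : ∀ a b, a ≤ b → Icc a b ⊆ S → μ.real (Ioc a b) = ∫ x in a..b, d x) {E : ℝ} (hE : E ∈ S) :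
    HasDerivAt (fun t : ℝ => μ.real (Ioc E t) - μ.real (Ioc t E)) (d E) E := by
  obtain ⟨l, r, hlr, hsub⟩ := mem_nhds_iff_exists_Ioo_subset.1 (hS.mem_nhds hE)
  have hF : HasDerivAt (fun t => ∫ x in E..t, d x) (d E) E := by
    refine intervalIntegral.integral_hasDerivAt_right (by simp) ?_ (hd E hE)
    exact ContinuousOn.stronglyMeasurableAtFilter hS
      (fun x hx => (hd x hx).continuousWithinAt) E hE
  refine hF.congr_of_eventuallyEq ?_
  filter_upwards [Ioo_mem_nhds hlr.1 hlr.2] with t ht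
  rcases le_total E t with hEt | htE
  · rw [h E t hEt fun y hy => hsub ⟨hlr.1.trans_le hy.1, hy.2.trans_lt ht.2⟩,
      Ioc_eq_empty (not_lt.2 hEt), measureReal_empty, sub_zero]
  · rw [h t E htE fun y hy => hsub ⟨ht.1.trans_le hy.1, hy.2.trans_lt hlr.2⟩,
      Ioc_eq_empty (not_lt.2 htE), measureReal_empty, zero_sub,
      intervalIntegral.integral_symm E t]
    ring

end Density

end HalfLine

theorem theorem7p1
    (V₀ V : ℝ → ℝ)
    (hV₀_per : Function.Periodic V₀ 1)
    (hV₀_int : IntegrableOn V₀ (Set.Icc 0 1) volume)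
    (hV : LocallyIntegrableOn V (Set.Ici 0) volume)
    (L : ℝ) (hL : 0 < L)
    -- the Floquet solution, the Dirichlet solution of the perturbed operator and its
    -- generalized Prüfer variable, for every energy in the bands
    (φ u ρ : ℝ → ℝ → ℂ)
    (hφ : ∀ E ∈ HalfLine.bands V₀, HalfLine.IsFloquetSolution V₀ E (φ E))
    (hu : ∀ E ∈ HalfLine.bands V₀,
      HalfLine.IsDirichletSolution (fun x => V₀ x + V x) (E : ℂ) (u E))
    (hρ : ∀ E ∈ HalfLine.bands V₀, HalfLine.IsPrufer (φ E) (u E) (ρ E))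
    -- the spectral measure of the eventually periodic operator
    (μ : Measure ℝ)
    (hμ : HalfLine.IsSpectralMeasure (fun x => V₀ x + HalfLine.cutoff V L x) μ) :
    -- on the bands, `μ` is absolutely continuous with the asserted density
    μ.restrict (HalfLine.bands V₀) =
        (volume.restrict (HalfLine.bands V₀)).withDensity (fun E => ENNReal.ofReal
          (2 / (Real.pi * ‖HalfLine.wronskian (fun t => conj (φ E t)) (φ E) 0‖)
            * (1 / ‖ρ E L‖ ^ 2))) ∧
      -- and at every point of the bands the distribution function of `μ` has that derivative
      ∀ E ∈ HalfLine.bands V₀,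
        HasDerivAt (fun t : ℝ => μ.real (Set.Ioc E t) - μ.real (Set.Ioc t E))
          (2 / (Real.pi * ‖HalfLine.wronskian (fun t => conj (φ E t)) (φ E) 0‖)
            * (1 / ‖ρ E L‖ ^ 2)) E := by
  obtain ⟨hμint, C, hC⟩ := hμ
  have hV₀ := HalfLine.intervalIntegrable_of_periodic hV₀_per hV₀_int
  have hS : IsOpen (HalfLine.bands V₀) := HalfLine.isOpen_bands fun X _ => hV₀ X
  have hfin := HalfLine.isLocallyFiniteMeasure_of_integrable hμint
  set γ : ℝ → ℝ := fun E =>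
    2 / (‖HalfLine.wronskian (fun t => conj (φ E t)) (φ E) 0‖ * ‖ρ E L‖ ^ 2) with hγ
  set d : ℝ → ℝ := fun E =>
    2 / (Real.pi * ‖HalfLine.wronskian (fun t => conj (φ E t)) (φ E) 0‖)
      * (1 / ‖ρ E L‖ ^ 2) with hd
  have hdγ : ∀ E, d E = γ E / Real.pi := by
    intro E
    simp only [hd, hγ]
    rw [div_mul_div_comm, mul_one, div_div]
    congr 1
    ring
  set M : ℂ → ℂ := fun z =>
    (C : ℂ) + ∫ x : ℝ, (1 / ((x : ℂ) - z) - (x : ℂ) / (1 + (x : ℂ) ^ 2)) ∂μ with hM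
  have him : ∀ z : ℂ, 0 < z.im → (M z).im = HalfLine.poissonIntegral μ z.re z.im :=
    fun z hz => HalfLine.im_herglotz hμint C hz
  have hbdry : ∀ E ∈ HalfLine.bands V₀,
      Tendsto (fun p : ℝ × ℝ => HalfLine.poissonIntegral μ p.1 p.2) (𝓝 E ×ˢ 𝓝[>] 0)
        (𝓝 (γ E)) := by
    intro E hE
    obtain ⟨m₀, hm₀, hlim⟩ := HalfLine.exists_tendsto_weylM hV₀_per hV₀_int hV hL hE (hφ E hE)
      (hu E hE) (hρ E hE) (M := M) (fun z hz => hC z hz.ne')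
      (fun z hz => by rw [him z hz]; exact HalfLine.poissonIntegral_nonneg μ _ hz)
    have hpos : ∀ᶠ p in 𝓝 E ×ˢ 𝓝[>] (0 : ℝ), 0 < p.2 :=
      tendsto_snd.eventually (eventually_mem_nhdsWithin (s := Ioi 0))
    have hmap : Tendsto (fun p : ℝ × ℝ => (p.1 : ℂ) + p.2 * Complex.I) (𝓝 E ×ˢ 𝓝[>] 0)
        (𝓝[{z | 0 < z.im}] (E : ℂ)) := by
      refine tendsto_nhdsWithin_iff.2 ⟨?_, hpos.mono fun p hp => by simpa using hp⟩
      have hc : Continuous fun p : ℝ × ℝ => (p.1 : ℂ) + p.2 * Complex.I := by fun_prop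
      have := hc.tendsto (E, 0)
      simp only [Complex.ofReal_zero, zero_mul, add_zero] at this
      refine this.mono_left ?_
      rw [nhds_prod_eq]
      exact Filter.prod_mono le_rfl nhdsWithin_le_nhds
    have h := (Complex.continuous_im.tendsto m₀).comp (hlim.comp hmap)
    rw [hm₀] at h
    refine h.congr' (hpos.mono fun p hp => ?_)
    have hz : 0 < ((p.1 : ℂ) + p.2 * Complex.I).im := by simpa using hp
    change (M ((p.1 : ℂ) + p.2 * Complex.I)).im = _
    rw [him _ hz]
    simp
  have hcont : ∀ E ∈ HalfLine.bands V₀, ContinuousAt d E := fun E hE => by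
    rw [show d = fun E => γ E / Real.pi from funext hdγ]
    exact (HalfLine.continuousAt_boundary_value hS hbdry hE).div_const _
  have hIoc : ∀ a b, a ≤ b → Icc a b ⊆ HalfLine.bands V₀ →
      μ.real (Ioc a b) = ∫ x in a..b, d x := by
    intro a b hab hsub
    have h := HalfLine.pi_mul_measureReal_Ioc hμint hbdry hab hsub
    simp_rw [hdγ]
    rw [intervalIntegral.integral_div, ← h]
    field_simp
  exact ⟨HalfLine.restrict_eq_withDensity_of_Ioc hS hcont
      (fun E _ => by positivity) hIoc,
    fun E hE => HalfLine.hasDerivAt_measureReal_Ioc hS hcont hIoc hE⟩
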